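/- Let $D\subsetneq\mathbb{C}$ be a simply connected region (open and connected) and let $\varphi$ be a conformal mapping in $D$, that is, analytic and univalent in $D$. Then there is a meromorphic, locally univalent function $f$ in $D$ whose Schwarzian derivative is $S_f=\varphi$ in $D$; moreover, for all $z\in D$, $\delta_{S_f(D)}(S_f(z))>0$ and $$\frac{|S_f'(z)|}{\delta_{S_f(D)}(S_f(z))}\le 4\,\lambda_D(z).$$ Here $S_f=(f''/f')'-\tfrac12(f''/f')^2$ (with $S_f:=S_{1/f}$ at the poles of $f$); "locally univalent" means that $f$, as a map into the Riemann sphere, is injective near each point of $D$; $\delta_\Omega(w)$ is the Euclidean distance from $w$ to $\partial\Omega$; and $\lambda_D(z)=1/|g'(0)|$, where $g$ is any conformal mapping of the unit disk onto $D$ with $g(0)=z$ (the hyperbolic density of curvature $-4$). -/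

import Mathlib

open Set Filter Topology

noncomputable section

/-- `f` is a conformal mapping in `D`: analytic and univalent (injective) on `D`. -/
def IsConformalMapping (f : ℂ → ℂ) (D : Set ℂ) : Prop :=
  DifferentiableOn ℂ f D ∧ InjOn f D

/-- The hyperbolic density (curvature `-4`) of a simply connected region `D ≠ ℂ`:
`λ_D(w) = 1 / |g'(0)|` for a conformal mapping `g` of the unit disk onto `D` with `g 0 = w`.
The value `1 / |g'(0)|` does not depend on the choice of `g`, so the set below is a singleton
for each `w ∈ D`, and its infimum is this common value. -/
def hyperbolicDensity (D : Set ℂ) (w : ℂ) : ℝ :=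
  sInf {r : ℝ | ∃ g : ℂ → ℂ, IsConformalMapping g (Metric.ball 0 1) ∧ g '' Metric.ball 0 1 = D ∧
    g 0 = w ∧ r = 1 / ‖deriv g 0‖}

/-- The Euclidean distance `δ_Ω(w)` from `w` to the boundary of `Ω`. -/
def boundaryDist (Ω : Set ℂ) (w : ℂ) : ℝ :=
  Metric.infDist w (frontier Ω)

/-- The pre-Schwarzian derivative `T_f = f'' / f'`. -/
def preSchwarzian (f : ℂ → ℂ) (z : ℂ) : ℂ :=
  deriv (deriv f) z / deriv f z

/-- The Schwarzian derivative `T_f' - T_f ^ 2 / 2` of a locally univalent analytic function. -/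
def analyticSchwarzian (f : ℂ → ℂ) (z : ℂ) : ℂ :=
  deriv (preSchwarzian f) z - (1 / 2) * preSchwarzian f z ^ 2

open Classical in
/-- The Schwarzian derivative of a locally univalent meromorphic function (in normal form):
the usual expression where `f` is analytic, and `S_{1/f}` at the poles of `f`. Away from zeros and
poles one has `S_{1/f} = S_f`, so this is the holomorphic extension of `S_f` to the poles. -/
def schwarzian (f : ℂ → ℂ) (z : ℂ) : ℂ :=
  if AnalyticAt ℂ f z then analyticSchwarzian f z else analyticSchwarzian f⁻¹ z

open Classical in
/-- A meromorphic function (in normal form) as a map to the Riemann sphere, equal to `∞` at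
the poles. -/
def toSphere (f : ℂ → ℂ) (z : ℂ) : OnePoint ℂ :=
  if AnalyticAt ℂ f z then ((f z : ℂ) : OnePoint ℂ) else OnePoint.infty

/-- `f` is a meromorphic and locally univalent function in `D`: it is meromorphic, normalized to be
analytic at its removable singularities (and with the dummy value `0` at its poles), and as a map to
the Riemann sphere it is injective in a neighbourhood of each point of `D`. -/
def IsLocallyUnivalentMeromorphic (f : ℂ → ℂ) (D : Set ℂ) : Prop :=
  MeromorphicNFOn f D ∧ ∀ z ∈ D, ∃ U ∈ 𝓝 z, InjOn (toSphere f) U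

end

/-! The existence of `f` needs only that φ is holomorphic. If y₁, y₂ are independent solutions of
y'' + (φ/2) y = 0, then f = y₁ / y₂ has Schwarzian derivative φ. Since f' = k / y₂² with k the
constant nonzero Wronskian, f is locally univalent; the zeros of y₂ are poles, where 1 / f takes
over. Global solutions exist because D is conformally a disk, on which the Picard series converges
(`exists_schwarzian_eq`).

For the inequality, S_f = φ is itself univalent. If g maps the unit disk conformally onto D with
g(0) = z, then φ ∘ g is univalent on the disk, and the Koebe one-quarter theorem bounds the distance
from φ(z) to the boundary of φ(D) below by |φ'(z)| |g'(0)| / 4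
(`norm_deriv_mul_norm_deriv_le_boundaryDist`). This is the claim, rearranged.

Two classical results carry the proof: the Riemann mapping theorem, by Koebe's extremal problem
(`exists_riemannMap`), and the chain from the area theorem (`norm_deriv_le_one_of_injOn_inv_add`)
through Bieberbach's inequality (`norm_deriv_dslope_le_two`) to Koebe's theorem. -/

/-! ### Univalent functions: open image, holomorphic inverse, nonvanishing derivative -/

section Univalent

variable {f : ℂ → ℂ} {U : Set ℂ}

theorem Set.InjOn.not_eventually_eq_const (hU : IsOpen U) (hi : InjOn f U) {z : ℂ} (hz : z ∈ U) :
    ¬ ∀ᶠ w in 𝓝 z, f w = f z := by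
  intro h
  have h1 : ∀ᶠ w in 𝓝[≠] z, w = z := by
    have h2 := h.and (hU.mem_nhds hz)
    filter_upwards [nhdsWithin_le_nhds h2] with w hw using hi hw.2 hz hw.1
  have h3 : ∀ᶠ w in 𝓝[≠] z, w ≠ z := eventually_mem_nhdsWithin
  obtain ⟨w, hw⟩ := (h1.and h3).exists
  exact hw.2 hw.1

theorem map_nhds_of_injOn (hU : IsOpen U) (hf : DifferentiableOn ℂ f U) (hi : InjOn f U) {z : ℂ}
    (hz : z ∈ U) : 𝓝 (f z) ≤ map f (𝓝 z) :=
  ((hf.analyticAt (hU.mem_nhds hz)).eventually_constant_or_nhds_le_map_nhds).resolve_left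
    (hi.not_eventually_eq_const hU hz)

theorem isOpen_image_of_injOn (hU : IsOpen U) (hf : DifferentiableOn ℂ f U) (hi : InjOn f U) :
    IsOpen (f '' U) := by
  rw [isOpen_iff_mem_nhds]
  rintro _ ⟨z, hz, rfl⟩
  exact map_nhds_of_injOn hU hf hi hz (image_mem_map (hU.mem_nhds hz))

theorem tendsto_leftInverse_of_injOn (hU : IsOpen U) (hf : DifferentiableOn ℂ f U)
    (hi : InjOn f U) {g : ℂ → ℂ} (hg : LeftInvOn g f U) {z : ℂ} (hz : z ∈ U) :
    Tendsto g (𝓝 (f z)) (𝓝 z) := by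
  intro V hV
  have h1 : f '' (V ∩ U) ∈ 𝓝 (f z) :=
    map_nhds_of_injOn hU hf hi hz (image_mem_map (inter_mem hV (hU.mem_nhds hz)))
  rw [mem_map]
  filter_upwards [h1]
  rintro _ ⟨w, hw, rfl⟩
  rw [mem_preimage, hg hw.2]
  exact hw.1

theorem eventually_deriv_ne_zero_of_injOn (hU : IsOpen U) (hf : DifferentiableOn ℂ f U)
    (hi : InjOn f U) {z : ℂ} (hz : z ∈ U) : ∀ᶠ w in 𝓝[≠] z, deriv f w ≠ 0 := by
  have ha := (hf.analyticAt (hU.mem_nhds hz)).deriv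
  refine ha.eventually_eq_zero_or_eventually_ne_zero.resolve_left fun h => ?_
  obtain ⟨r, hr, hb⟩ := Metric.eventually_nhds_iff_ball.1 (h.and (hU.mem_nhds hz))
  refine hi.not_eventually_eq_const hU hz ?_
  filter_upwards [Metric.ball_mem_nhds z hr] with w hw
  exact Metric.isOpen_ball.is_const_of_deriv_eq_zero (convex_ball z r).isPreconnected
    (hf.mono fun x hx => (hb x hx).2) (fun x hx => (hb x hx).1) hw (Metric.mem_ball_self hr)

/-- Zeros of f' are isolated, so g is differentiable on a punctured neighbourhood of f z; it is
continuous at f z because f is open, so the singularity is removable. That f' has no zeros at all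
then follows from the chain rule for g ∘ f. -/
theorem differentiableAt_leftInverse_of_injOn (hU : IsOpen U) (hf : DifferentiableOn ℂ f U)
    (hi : InjOn f U) {g : ℂ → ℂ} (hg : LeftInvOn g f U) {z : ℂ} (hz : z ∈ U) :
    DifferentiableAt ℂ g (f z) := by
  refine AnalyticAt.differentiableAt
    (Complex.analyticAt_of_differentiable_on_punctured_nhds_of_continuousAt ?_ ?_)
  · rw [eventually_nhdsWithin_iff]
    have h1 := eventually_nhdsWithin_iff.1 (eventually_deriv_ne_zero_of_injOn hU hf hi hz)
    have h2 := image_mem_map (m := f) (h1.and (hU.mem_nhds hz))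
    filter_upwards [map_nhds_of_injOn hU hf hi hz h2]
    rintro _ ⟨w, ⟨hw, hwU⟩, rfl⟩ hne
    have hd : HasDerivAt f (deriv f w) (g (f w)) := by
      rw [hg hwU]; exact (hf.differentiableAt (hU.mem_nhds hwU)).hasDerivAt
    have hc : ContinuousAt g (f w) := by
      rw [ContinuousAt, hg hwU]
      exact tendsto_leftInverse_of_injOn hU hf hi hg hwU
    refine (hd.of_local_left_inverse hc (hw fun h => hne (by simp_all)) ?_).differentiableAt
    filter_upwards [(isOpen_image_of_injOn hU hf hi).mem_nhds (mem_image_of_mem f hwU)]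
    rintro _ ⟨x, hx, rfl⟩
    rw [hg hx]
  · rw [ContinuousAt, hg hz]
    exact tendsto_leftInverse_of_injOn hU hf hi hg hz

theorem differentiableOn_leftInverse_of_injOn (hU : IsOpen U) (hf : DifferentiableOn ℂ f U)
    (hi : InjOn f U) {g : ℂ → ℂ} (hg : LeftInvOn g f U) : DifferentiableOn ℂ g (f '' U) := by
  rintro _ ⟨z, hz, rfl⟩
  exact (differentiableAt_leftInverse_of_injOn hU hf hi hg hz).differentiableWithinAt

theorem deriv_leftInverse_mul_deriv (hU : IsOpen U) (hf : DifferentiableOn ℂ f U)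
    (hi : InjOn f U) {g : ℂ → ℂ} (hg : LeftInvOn g f U) {z : ℂ} (hz : z ∈ U) :
    deriv g (f z) * deriv f z = 1 := by
  rw [← deriv_comp z (differentiableAt_leftInverse_of_injOn hU hf hi hg hz)
    (hf.differentiableAt (hU.mem_nhds hz))]
  have : g ∘ f =ᶠ[𝓝 z] id := by
    filter_upwards [hU.mem_nhds hz] with w hw using hg hw
  rw [this.deriv_eq, deriv_id]

theorem deriv_ne_zero_of_injOn (hU : IsOpen U) (hf : DifferentiableOn ℂ f U)
    (hi : InjOn f U) {z : ℂ} (hz : z ∈ U) : deriv f z ≠ 0 := by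
  intro h
  have := deriv_leftInverse_mul_deriv hU hf hi hi.leftInvOn_invFunOn hz
  simp [h] at this

end Univalent

/-! ### Montel, Hurwitz and the Riemann mapping theorem -/

section RiemannMapping

open Metric ComplexConjugate

/-- The automorphism `z ↦ (z - a) / (1 - conj a * z)` of the unit disk. -/
noncomputable def discAut (a z : ℂ) : ℂ := (z - a) / (1 - conj a * z)

theorem one_sub_conj_mul_ne_zero {a z : ℂ} (ha : ‖a‖ < 1) (hz : ‖z‖ < 1) : 1 - conj a * z ≠ 0 := by
  intro h
  have h1 : ‖conj a * z‖ = 1 := by rw [← sub_eq_zero.1 h, norm_one]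
  rw [norm_mul, RCLike.norm_conj] at h1
  nlinarith [norm_nonneg a, norm_nonneg z]

theorem norm_discAut_lt_one {a z : ℂ} (ha : ‖a‖ < 1) (hz : ‖z‖ < 1) : ‖discAut a z‖ < 1 := by
  have h0 := one_sub_conj_mul_ne_zero ha hz
  rw [discAut, norm_div, div_lt_one (norm_pos_iff.2 h0)]
  refine lt_of_pow_lt_pow_left₀ 2 (norm_nonneg _) ?_
  have key : ‖1 - conj a * z‖ ^ 2 - ‖z - a‖ ^ 2 = (1 - ‖a‖ ^ 2) * (1 - ‖z‖ ^ 2) := by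
    simp only [Complex.sq_norm, Complex.normSq_apply, Complex.sub_re, Complex.sub_im,
      Complex.mul_re, Complex.mul_im, Complex.conj_re, Complex.conj_im, Complex.one_re,
      Complex.one_im]
    ring
  have h1 : 0 < (1 - ‖a‖ ^ 2) * (1 - ‖z‖ ^ 2) := by
    apply mul_pos <;> nlinarith [norm_nonneg a, norm_nonneg z]
  linarith

theorem hasDerivAt_discAut {a z : ℂ} (ha : ‖a‖ < 1) (hz : ‖z‖ < 1) :
    HasDerivAt (discAut a) ((1 - conj a * a) / (1 - conj a * z) ^ 2) z := by
  have h0 := one_sub_conj_mul_ne_zero ha hz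
  have h1 : HasDerivAt (fun w : ℂ => w - a) 1 z := (hasDerivAt_id z).sub_const a
  have h2 : HasDerivAt (fun w : ℂ => 1 - conj a * w) (-(conj a * 1)) z :=
    ((hasDerivAt_id z).const_mul _).const_sub 1
  convert! h1.div h2 h0 using 1
  congr 1
  ring

theorem discAut_neg_discAut {a z : ℂ} (ha : ‖a‖ < 1) (hz : ‖z‖ < 1) :
    discAut (-a) (discAut a z) = z := by
  have h0 := one_sub_conj_mul_ne_zero ha hz
  have h1 := one_sub_conj_mul_ne_zero ha ha
  have h3 : 1 - conj a * z + conj a * (z - a) ≠ 0 := by convert h1 using 1; ring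
  simp only [discAut, map_neg]
  have h4 : (1 : ℂ) - -conj a * ((z - a) / (1 - conj a * z)) =
      (1 - conj a * z + conj a * (z - a)) / (1 - conj a * z) := by
    rw [eq_div_iff h0, sub_mul, mul_assoc, div_mul_cancel₀ _ h0]; ring
  have h5 : (z - a) / (1 - conj a * z) - -a = z * (1 - conj a * z + conj a * (z - a)) /
      (1 - conj a * z) := by
    rw [eq_div_iff h0, sub_mul, div_mul_cancel₀ _ h0]; ring
  rw [h4, h5, div_div_div_cancel_right₀ h0, mul_div_cancel_right₀ _ h3]

theorem discAut_injOn {a : ℂ} (ha : ‖a‖ < 1) : InjOn (discAut a) (ball 0 1) := by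
  intro z hz w hw h
  rw [mem_ball_zero_iff] at hz hw
  rw [← discAut_neg_discAut ha hz, h, discAut_neg_discAut ha hw]

theorem discAut_differentiableOn {a : ℂ} (ha : ‖a‖ < 1) :
    DifferentiableOn ℂ (discAut a) (ball 0 1) := fun _ hz =>
  (hasDerivAt_discAut ha (mem_ball_zero_iff.1 hz)).differentiableAt.differentiableWithinAt

theorem discAut_mapsTo {a : ℂ} (ha : ‖a‖ < 1) : MapsTo (discAut a) (ball 0 1) (ball 0 1) := by
  intro z hz
  rw [mem_ball_zero_iff] at hz ⊢
  exact norm_discAut_lt_one ha hz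

/-- A form of **Montel's theorem**: a sequence of holomorphic maps to the unit disk converges
locally uniformly along every ultrafilter. -/
theorem exists_tendstoLocallyUniformlyOn_of_mapsTo_ball {ι : Type*} (l : Ultrafilter ι)
    {F : ι → ℂ → ℂ} {U : Set ℂ} (hU : IsOpen U) (hF : ∀ i, DifferentiableOn ℂ (F i) U)
    (hm : ∀ i, MapsTo (F i) U (ball 0 1)) :
    ∃ f, TendstoLocallyUniformlyOn F f l U := by
  -- Along an ultrafilter, compactness alone gives pointwise limits; no diagonal subsequence is
  -- needed.
  have hpt : ∀ z ∈ U, ∃ w, Tendsto (fun i => F i z) l (𝓝 w) := by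
    intro z hz
    obtain ⟨w, -, hw⟩ := (isCompact_closedBall (0 : ℂ) 1).ultrafilter_le_nhds
      (l.map fun i => F i z)
      (by
        rw [Ultrafilter.coe_map]
        exact tendsto_principal.2
          (Filter.Eventually.of_forall fun i => ball_subset_closedBall (hm i hz)))
    exact ⟨w, hw⟩
  choose! f hf using hpt
  refine ⟨f, Metric.tendstoLocallyUniformlyOn_iff.2 fun ε hε x hx => ?_⟩
  obtain ⟨r, hr, hrU⟩ := Metric.isOpen_iff.1 hU x hx
  -- Equicontinuity from the Schwarz lemma; 2 is the diameter of the target disk.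
  have hlip : ∀ i, ∀ y ∈ ball x r, dist (F i y) (F i x) ≤ 2 / r * dist y x := by
    intro i y hy
    refine Complex.dist_le_div_mul_dist_of_mapsTo_ball ((hF i).mono hrU) ?_ hy
    intro w hw
    have h1 := mem_ball_zero_iff.1 (hm i (hrU hw))
    have h2 := mem_ball_zero_iff.1 (hm i hx)
    rw [mem_closedBall, dist_eq_norm]
    exact (norm_sub_le _ _).trans (by linarith)
  have hlip' : ∀ y ∈ ball x r, dist (f y) (f x) ≤ 2 / r * dist y x := fun y hy =>
    le_of_tendsto ((hf y (hrU hy)).dist (hf x hx)) (Filter.Eventually.of_forall fun i => hlip i y hy)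
  set δ := min r (r * ε / 8) with hδ
  have hδ0 : 0 < δ := lt_min hr (by positivity)
  refine ⟨ball x δ, mem_nhdsWithin_of_mem_nhds (ball_mem_nhds x hδ0), ?_⟩
  filter_upwards [(Metric.tendsto_nhds.1 (hf x hx)) (ε / 4) (by positivity)] with i hi y hy
  have hyr : y ∈ ball x r := ball_subset_ball (min_le_left _ _) hy
  have hsm : 2 / r * dist y x ≤ ε / 4 := by
    have : dist y x ≤ r * ε / 8 := (mem_ball.1 hy).le.trans (min_le_right _ _)
    calc 2 / r * dist y x ≤ 2 / r * (r * ε / 8) := by gcongr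
      _ = ε / 4 := by field_simp; norm_num
  have h1 := hlip i y hyr
  have h2 := hlip' y hyr
  have h3 : dist (f y) (F i y) ≤ dist (f y) (f x) + dist (f x) (F i x) + dist (F i x) (F i y) :=
    dist_triangle4 _ _ _ _
  rw [dist_comm (f x), dist_comm (F i x) (F i y)] at h3
  linarith

/-- A form of **Hurwitz's theorem**: a locally uniform limit of zero-free holomorphic functions
has no isolated zeros. -/
theorem eventually_eq_zero_of_tendstoLocallyUniformlyOn {ι : Type*} {l : Filter ι} [NeBot l]
    {F : ι → ℂ → ℂ} {f : ℂ → ℂ} {U : Set ℂ} (hU : IsOpen U)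
    (hF : ∀ i, DifferentiableOn ℂ (F i) U) (hlim : TendstoLocallyUniformlyOn F f l U)
    (h0 : ∀ i, ∀ z ∈ U, F i z ≠ 0) {b : ℂ} (hb : b ∈ U) (hfb : f b = 0) :
    ∀ᶠ z in 𝓝 b, f z = 0 := by
  have hfd : DifferentiableOn ℂ f U := hlim.differentiableOn (Filter.Eventually.of_forall hF) hU
  refine (hfd.analyticAt (hU.mem_nhds hb)).eventually_eq_zero_or_eventually_ne_zero.resolve_right
    fun hne => ?_
  rw [eventually_nhdsWithin_iff] at hne
  obtain ⟨r, hr, hrs⟩ := Metric.nhds_basis_closedBall.eventually_iff.1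
    (hne.and (hU.mem_nhds hb))
  have hrU : closedBall b r ⊆ U := fun z hz => (hrs hz).2
  have hsph : ∀ z ∈ sphere b r, f z ≠ 0 := fun z hz =>
    (hrs (sphere_subset_closedBall hz)).1 (by
      rintro rfl
      simp at hz
      linarith)
  obtain ⟨m, hm0, hm⟩ : ∃ m > 0, ∀ z ∈ sphere b r, m ≤ ‖f z‖ := by
    obtain ⟨z₀, hz₀, hmin⟩ := (isCompact_sphere b r).exists_isMinOn
      (NormedSpace.sphere_nonempty.2 hr.le)
      ((hfd.continuousOn.mono (sphere_subset_closedBall.trans hrU)).norm)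
    exact ⟨‖f z₀‖, norm_pos_iff.2 (hsph z₀ hz₀), fun z hz => hmin hz⟩
  have hunif := (tendstoLocallyUniformlyOn_iff_forall_isCompact hU).1 hlim _ hrU
    (isCompact_closedBall b r)
  obtain ⟨i, hi⟩ := (Metric.tendstoUniformlyOn_iff.1 hunif (m / 2) (by positivity)).exists
  have hbb : b ∈ closedBall b r := mem_closedBall_self hr.le
  -- Maximum principle for 1 / F i: on the circle |F i| ≥ m / 2, hence also at b. But F i b lies
  -- within less than m / 2 of f b = 0.
  have hinv : ‖(F i b)⁻¹‖ ≤ (m / 2)⁻¹ := by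
    refine Complex.norm_le_of_forall_mem_frontier_norm_le (f := fun z => (F i z)⁻¹)
      (isBounded_ball (x := b) (r := r)) ?_ ?_ (subset_closure (mem_ball_self hr))
    · refine DifferentiableOn.diffContOnCl ?_
      rw [closure_ball b hr.ne']
      exact ((hF i).mono hrU).inv fun z hz => h0 i z (hrU hz)
    · intro z hz
      rw [frontier_ball b hr.ne'] at hz
      rw [norm_inv]
      have h1 := hi z (sphere_subset_closedBall hz)
      have h2 := hm z hz
      rw [dist_eq_norm] at h1
      have h3 := norm_sub_norm_le (f z) (F i z)
      exact inv_anti₀ (by positivity) (by linarith)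
  have h1 := hi b hbb
  rw [hfb, dist_zero_left] at h1
  rw [norm_inv] at hinv
  have := (inv_le_inv₀ (norm_pos_iff.2 (h0 i b hb)) (by positivity)).1 hinv
  linarith

/-- **Hurwitz's theorem** on locally uniform limits of univalent functions. -/
theorem injOn_of_tendstoLocallyUniformlyOn {ι : Type*} {l : Filter ι} [NeBot l]
    {F : ι → ℂ → ℂ} {f : ℂ → ℂ} {U : Set ℂ} (hU : IsOpen U) (hUc : IsPreconnected U)
    (hF : ∀ i, DifferentiableOn ℂ (F i) U) (hi : ∀ i, InjOn (F i) U)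
    (hlim : TendstoLocallyUniformlyOn F f l U) {z₀ : ℂ} (hz₀ : z₀ ∈ U) (hd : deriv f z₀ ≠ 0) :
    InjOn f U := by
  have hfd : DifferentiableOn ℂ f U := hlim.differentiableOn (Filter.Eventually.of_forall hF) hU
  intro a ha b hb hab
  by_contra hne
  have hev : ∀ᶠ z in 𝓝 b, f z - f a = 0 := by
    -- By univalence F i - F i a has no zero away from a, so its limit f - f a cannot have an
    -- isolated zero at b.
    refine eventually_eq_zero_of_tendstoLocallyUniformlyOn (l := l) (U := U \ {a})
      (F := fun i z => F i z - F i a) (hU.sdiff isClosed_singleton) (fun i => ?_) ?_ ?_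
      ⟨hb, fun h => hne h.symm⟩ (by rw [hab, sub_self])
    · exact ((hF i).mono sdiff_subset).sub_const _
    · refine (hlim.mono sdiff_subset).sub ?_
      rw [Metric.tendstoLocallyUniformlyOn_iff]
      intro ε hε x _
      refine ⟨univ, univ_mem, ?_⟩
      filter_upwards [Metric.tendsto_nhds.1 (hlim.tendsto_at ha) ε hε] with i h y _
      rwa [dist_comm]
    · intro i z hz h
      exact hz.2 (hi i hz.1 ha (sub_eq_zero.1 h))
  have heq : EqOn f (fun _ => f a) U :=
    (hfd.analyticOnNhd hU).eqOn_of_preconnected_of_eventuallyEq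
      (fun _ _ => analyticAt_const) hUc hb (by
        filter_upwards [hev] with z hz using sub_eq_zero.1 hz)
  apply hd
  have : f =ᶠ[𝓝 z₀] fun _ => f a := by
    filter_upwards [hU.mem_nhds hz₀] with z hz using heq hz
  rw [this.deriv_eq, deriv_const]

/-- The slope of h is the slope of k = h² divided by h w + h z, so continuity of h suffices. -/
theorem hasDerivAt_of_sq_eq {h k : ℂ → ℂ} {U : Set ℂ} (hU : IsOpen U) (hc : ContinuousOn h U)
    (hk : DifferentiableOn ℂ k U) (hsq : ∀ z ∈ U, h z ^ 2 = k z) (h0 : ∀ z ∈ U, k z ≠ 0) {z : ℂ}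
    (hz : z ∈ U) : HasDerivAt h (deriv k z / (2 * h z)) z := by
  have hne : ∀ w ∈ U, h w ≠ 0 := fun w hw e => h0 w hw (by rw [← hsq w hw, e]; simp)
  have hkz := (hk.differentiableAt (hU.mem_nhds hz)).hasDerivAt
  rw [hasDerivAt_iff_tendsto_slope] at hkz ⊢
  have hcz : Tendsto h (𝓝[≠] z) (𝓝 (h z)) :=
    (hc.continuousAt (hU.mem_nhds hz)).mono_left nhdsWithin_le_nhds
  have hsum : Tendsto (fun w => h w + h z) (𝓝[≠] z) (𝓝 (2 * h z)) := by
    rw [two_mul]; exact hcz.add_const _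
  have h2 : 2 * h z ≠ 0 := mul_ne_zero two_ne_zero (hne z hz)
  refine (hkz.div hsum h2).congr' ?_
  filter_upwards [hsum.eventually_ne h2, nhdsWithin_le_nhds (hU.mem_nhds hz)] with w hw hwU
  rw [Pi.div_apply, slope_def_field, slope_def_field, ← hsq w hwU, ← hsq z hz, div_right_comm]
  congr 1
  rw [div_eq_iff hw]
  ring

/-- Beyond connectedness, this is how simple connectivity enters the Riemann mapping theorem. -/
theorem exists_differentiableOn_sq_eq {U : Set ℂ} (hU : IsOpen U) (hs : IsSimplyConnected U)
    {k : ℂ → ℂ} (hk : DifferentiableOn ℂ k U) (h0 : ∀ z ∈ U, k z ≠ 0) :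
    ∃ h, DifferentiableOn ℂ h U ∧ ∀ z ∈ U, h z ^ 2 = k z := by
  obtain ⟨h, hc, hsq⟩ := Complex.exists_continuousOn_pow_eq hs hU hk.continuousOn
    (by rintro ⟨z, hz, h⟩; exact h0 z hz h) two_ne_zero
  exact ⟨h, fun z hz => (hasDerivAt_of_sq_eq hU hc hk (fun z _ => hsq z) h0
    hz).differentiableAt.differentiableWithinAt, fun z _ => hsq z⟩

/-- A branch h of √(z - a), with a outside U, never takes both w and -w. As h(U) contains a disk
about h x, it misses the disk about -h x, and an inversion centred there makes h bounded. -/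
theorem exists_injOn_mapsTo_ball {U : Set ℂ} (hU : IsOpen U) (hs : IsSimplyConnected U)
    (hne : U ≠ univ) :
    ∃ f : ℂ → ℂ, DifferentiableOn ℂ f U ∧ InjOn f U ∧ MapsTo f U (ball 0 1) := by
  obtain ⟨a, ha⟩ := (ne_univ_iff_exists_notMem U).1 hne
  obtain ⟨h, hd, hsq⟩ := exists_differentiableOn_sq_eq hU hs (k := fun z => z - a)
    (differentiableOn_id.sub_const a) (fun z hz e => ha (by rwa [← sub_eq_zero.1 e]))
  have hinj : InjOn h U := fun z hz w hw e => by
    have := hsq z hz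
    rw [e, hsq w hw] at this
    exact (sub_left_injective this).symm
  obtain ⟨x, hx⟩ := hs.nonempty
  have himg : ∀ᶠ w in 𝓝 (h x), w ∈ h '' U :=
    (isOpen_image_of_injOn hU hd hinj).mem_nhds (mem_image_of_mem h hx)
  obtain ⟨ε, hε, hb⟩ := Metric.eventually_nhds_iff_ball.1 himg
  have hfar : ∀ z ∈ U, ε ≤ ‖h z + h x‖ := by
    intro z hz
    by_contra! hlt
    obtain ⟨w, hw, hwz⟩ := hb (-h z) (by
      rw [mem_ball, dist_eq_norm, show -h z - h x = -(h z + h x) by ring, norm_neg]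
      exact hlt)
    have hzw : z = w := by
      have h1 := hsq w hw
      rw [hwz, neg_sq, hsq z hz] at h1
      exact sub_left_injective h1
    subst hzw
    have h0 : h z = 0 := by linear_combination hwz / 2
    have h1 := hsq z hz
    rw [h0] at h1
    exact ha (by rwa [← sub_eq_zero.1 (h1.symm.trans (by simp) : z - a = 0)])
  have hpos : ∀ z ∈ U, h z + h x ≠ 0 := fun z hz => norm_pos_iff.1 (hε.trans_le (hfar z hz))
  refine ⟨fun z => (ε / 2 : ℝ) / (h z + h x), ?_, ?_, ?_⟩
  · exact (differentiableOn_const _).div (hd.add_const _) hpos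
  · intro z hz w hw e
    have hε2 : ((ε / 2 : ℝ) : ℂ) ≠ 0 := by exact_mod_cast (half_pos hε).ne'
    have e' : ((ε / 2 : ℝ) : ℂ) / (h z + h x) = (ε / 2 : ℝ) / (h w + h x) := e
    rw [div_eq_div_iff (hpos z hz) (hpos w hw)] at e'
    exact hinj hz hw (add_right_cancel (mul_left_cancel₀ hε2 e').symm)
  · intro z hz
    rw [mem_ball_zero_iff, norm_div, div_lt_one (norm_pos_iff.2 (hpos z hz)), Complex.norm_real,
      Real.norm_of_nonneg (half_pos hε).le]
    linarith [hfar z hz]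

/-- The univalent maps of `U` into the unit disk that vanish at `z₀`. -/
def discMaps (U : Set ℂ) (z₀ : ℂ) : Set (ℂ → ℂ) :=
  {f | DifferentiableOn ℂ f U ∧ InjOn f U ∧ MapsTo f U (ball 0 1) ∧ f z₀ = 0}

theorem discAut_comp_mem_discMaps {U : Set ℂ} {z₀ : ℂ} (hz₀ : z₀ ∈ U) {f : ℂ → ℂ}
    (hf : DifferentiableOn ℂ f U) (hi : InjOn f U) (hm : MapsTo f U (ball 0 1)) :
    discAut (f z₀) ∘ f ∈ discMaps U z₀ := by
  have ha : ‖f z₀‖ < 1 := mem_ball_zero_iff.1 (hm hz₀)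
  exact ⟨(discAut_differentiableOn ha).comp hf hm, (discAut_injOn ha).comp hi hm,
    (discAut_mapsTo ha).comp hm, by simp [discAut]⟩

/-- A maximizing sequence converges by Montel. Its limit has derivative of modulus `sSup S` > 0 at
z₀, so it is not constant and Hurwitz makes it univalent. -/
theorem exists_isMaxOn_norm_deriv_discMaps {U : Set ℂ} (hU : IsOpen U) (hUc : IsPreconnected U)
    {z₀ : ℂ} (hz₀ : z₀ ∈ U) (hne : (discMaps U z₀).Nonempty) :
    ∃ f ∈ discMaps U z₀, ∀ g ∈ discMaps U z₀, ‖deriv g z₀‖ ≤ ‖deriv f z₀‖ := by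
  set S : Set ℝ := (fun g => ‖deriv g z₀‖) '' discMaps U z₀ with hS
  obtain ⟨r, hr, hrU⟩ := Metric.isOpen_iff.1 hU z₀ hz₀
  have hbdd : BddAbove S := by
    refine ⟨1 / r, ?_⟩
    rintro _ ⟨g, ⟨hd, -, hm, hg0⟩, rfl⟩
    refine Complex.norm_deriv_le_div_of_mapsTo_ball (hd.mono hrU) ?_ hr
    rw [hg0]
    exact (hm.mono_left hrU).mono_right ball_subset_closedBall
  obtain ⟨u, -, hulim, hu⟩ := exists_seq_tendsto_sSup (hne.image _) hbdd
  choose F hF hFu using hu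
  obtain ⟨f, hlim⟩ := exists_tendstoLocallyUniformlyOn_of_mapsTo_ball (hyperfilter ℕ) hU
    (fun n => (hF n).1) (fun n => (hF n).2.2.1)
  have hfd : DifferentiableOn ℂ f U :=
    hlim.differentiableOn (Filter.Eventually.of_forall fun n => (hF n).1) hU
  have hder : ‖deriv f z₀‖ = sSup S := by
    have h1 := ((hlim.deriv (Filter.Eventually.of_forall fun n => (hF n).1) hU).tendsto_at
      hz₀).norm
    refine tendsto_nhds_unique (h1.congr fun n => ?_) (hulim.mono_left Nat.hyperfilter_le_atTop)
    exact hFu n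
  have hd0 : deriv f z₀ ≠ 0 := by
    obtain ⟨g, hg⟩ := hne
    have h1 : 0 < ‖deriv g z₀‖ := norm_pos_iff.2 (deriv_ne_zero_of_injOn hU hg.1 hg.2.1 hz₀)
    rw [← norm_pos_iff, hder]
    exact h1.trans_le (le_csSup hbdd (mem_image_of_mem _ hg))
  have hinj : InjOn f U := injOn_of_tendstoLocallyUniformlyOn hU hUc (fun n => (hF n).1)
    (fun n => (hF n).2.1) hlim hz₀ hd0
  refine ⟨f, ⟨hfd, hinj, ?_, ?_⟩, fun g hg => ?_⟩
  -- The limit is only known to land in the closed disk; openness of its image excludes the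
  -- boundary.
  · have hcl : f '' U ⊆ closedBall 0 1 := by
      rintro _ ⟨z, hz, rfl⟩
      rw [mem_closedBall_zero_iff]
      exact le_of_tendsto (hlim.tendsto_at hz).norm
        (Filter.Eventually.of_forall fun n => (mem_ball_zero_iff.1 ((hF n).2.2.1 hz)).le)
    have h1 := interior_maximal hcl (isOpen_image_of_injOn hU hfd hinj)
    rw [interior_closedBall _ one_ne_zero] at h1
    exact mapsTo_iff_image_subset.2 h1
  · refine tendsto_nhds_unique (hlim.tendsto_at hz₀) ?_
    exact tendsto_const_nhds.congr fun n => ((hF n).2.2.2).symm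
  · rw [hder]
    exact le_csSup hbdd (mem_image_of_mem _ hg)

/-- Koebe's square root trick: move the omitted value w to 0 by an automorphism, take a square root
h and recentre. With t = |h z₀| = √|w| the derivative at z₀ grows by the factor (1 + t²) / (2t) > 1.
-/
theorem exists_norm_deriv_lt_of_notMem_image {U : Set ℂ} (hU : IsOpen U)
    (hs : IsSimplyConnected U) {z₀ : ℂ} (hz₀ : z₀ ∈ U) {f : ℂ → ℂ} (hf : f ∈ discMaps U z₀) {w : ℂ}
    (hw : ‖w‖ < 1) (hwf : w ∉ f '' U) :
    ∃ g ∈ discMaps U z₀, ‖deriv f z₀‖ < ‖deriv g z₀‖ := by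
  obtain ⟨hd, hi, hm, hf0⟩ := hf
  have hw0 : w ≠ 0 := by
    rintro rfl
    exact hwf ⟨z₀, hz₀, hf0⟩
  have hn : ∀ z ∈ U, ‖f z‖ < 1 := fun z hz => mem_ball_zero_iff.1 (hm hz)
  have hkd : DifferentiableOn ℂ (discAut w ∘ f) U := (discAut_differentiableOn hw).comp hd hm
  have hk0 : ∀ z ∈ U, (discAut w ∘ f) z ≠ 0 := by
    intro z hz h
    rcases div_eq_zero_iff.1 h with h | h
    · exact hwf ⟨z, hz, sub_eq_zero.1 h⟩
    · exact one_sub_conj_mul_ne_zero hw (hn z hz) h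
  obtain ⟨h, hhd, hsq⟩ := exists_differentiableOn_sq_eq hU hs hkd hk0
  have hhm : MapsTo h U (ball 0 1) := by
    intro z hz
    have h1 : ‖h z‖ ^ 2 < 1 := by
      rw [← norm_pow, hsq z hz]
      exact norm_discAut_lt_one hw (hn z hz)
    rw [mem_ball_zero_iff]
    nlinarith [norm_nonneg (h z)]
  have hhi : InjOn h U := by
    intro x hx y hy e
    have h1 := hsq x hx
    rw [e, hsq y hy] at h1
    exact ((discAut_injOn hw).comp hi hm) hx hy h1.symm
  refine ⟨_, discAut_comp_mem_discMaps hz₀ hhd hhi hhm, ?_⟩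
  have hz1 : ‖h z₀‖ < 1 := mem_ball_zero_iff.1 (hhm hz₀)
  have hh2 : h z₀ ^ 2 = -w := by rw [hsq z₀ hz₀]; simp [discAut, hf0]
  have hhn : ‖h z₀‖ ^ 2 = ‖w‖ := by rw [← norm_pow, hh2, norm_neg]
  have hhpos : 0 < ‖h z₀‖ := by
    refine norm_pos_iff.2 fun e => hw0 ?_
    rw [← neg_eq_zero, ← hh2, e]
    simp
  have hfz : HasDerivAt f (deriv f z₀) z₀ := (hd.differentiableAt (hU.mem_nhds hz₀)).hasDerivAt
  have hk' : deriv (discAut w ∘ f) z₀ = (1 - conj w * w) * deriv f z₀ := by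
    have := (hasDerivAt_discAut hw (hn z₀ hz₀)).comp z₀ hfz
    rw [this.deriv, hf0]
    simp
  have hh' := hasDerivAt_of_sq_eq hU hhd.continuousOn hkd hsq hk0 hz₀
  rw [hk'] at hh'
  have hg' := ((hasDerivAt_discAut hz1 hz1).comp z₀ hh').deriv
  have hc : ∀ a : ℂ, 1 - conj a * a = ((1 - ‖a‖ ^ 2 : ℝ) : ℂ) := by
    intro a
    rw [mul_comm, Complex.mul_conj, Complex.normSq_eq_norm_sq]
    push_cast
    ring
  rw [hg']
  set t := ‖h z₀‖ with ht
  have ht2 : 0 < 1 - t ^ 2 := by nlinarith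
  have ht4 : 0 < 1 - (t ^ 2) ^ 2 := by nlinarith
  rw [hc, hc, norm_mul, norm_div, norm_div, norm_mul, norm_mul, norm_pow, Complex.norm_real,
    Complex.norm_real, ← hhn, ← ht, Real.norm_of_nonneg ht2.le, Real.norm_of_nonneg ht4.le,
    Complex.norm_two]
  have hdpos : 0 < ‖deriv f z₀‖ := norm_pos_iff.2 (deriv_ne_zero_of_injOn hU hd hi hz₀)
  have : (1 - t ^ 2) / (1 - t ^ 2) ^ 2 * ((1 - (t ^ 2) ^ 2) * ‖deriv f z₀‖ / (2 * t)) =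
      ‖deriv f z₀‖ * ((1 + t ^ 2) / (2 * t)) := by
    field_simp
    ring
  rw [this]
  refine lt_mul_of_one_lt_right hdpos ?_
  rw [one_lt_div (by positivity)]
  nlinarith [sq_pos_of_pos (sub_pos.2 hz1)]

/-- The **Riemann mapping theorem**. -/
theorem exists_riemannMap {U : Set ℂ} (hU : IsOpen U) (hs : IsSimplyConnected U)
    (hne : U ≠ univ) {z₀ : ℂ} (hz₀ : z₀ ∈ U) :
    ∃ f : ℂ → ℂ, DifferentiableOn ℂ f U ∧ InjOn f U ∧ f '' U = ball 0 1 ∧ f z₀ = 0 := by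
  obtain ⟨f₀, hd₀, hi₀, hm₀⟩ := exists_injOn_mapsTo_ball hU hs hne
  obtain ⟨f, hf, hmax⟩ := exists_isMaxOn_norm_deriv_discMaps hU
    hs.isPathConnected.isConnected.isPreconnected hz₀
    ⟨_, discAut_comp_mem_discMaps hz₀ hd₀ hi₀ hm₀⟩
  refine ⟨f, hf.1, hf.2.1, (image_subset_iff.2 hf.2.2.1).antisymm fun w hw => ?_, hf.2.2.2⟩
  by_contra hwf
  obtain ⟨g, hg, hlt⟩ := exists_norm_deriv_lt_of_notMem_image hU hs hz₀ hf
    (mem_ball_zero_iff.1 hw) hwf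
  exact hlt.not_ge (hmax g hg)

/-- The **Riemann mapping theorem**, for maps from the unit disk. -/
theorem exists_riemannMap_of_ball {U : Set ℂ} (hU : IsOpen U) (hs : IsSimplyConnected U)
    (hne : U ≠ univ) {z₀ : ℂ} (hz₀ : z₀ ∈ U) :
    ∃ g : ℂ → ℂ, DifferentiableOn ℂ g (ball 0 1) ∧ InjOn g (ball 0 1) ∧ g '' ball 0 1 = U ∧
      g 0 = z₀ := by
  obtain ⟨f, hd, hi, him, hf0⟩ := exists_riemannMap hU hs hne hz₀
  have hl : LeftInvOn (Function.invFunOn f U) f U := hi.leftInvOn_invFunOn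
  refine ⟨Function.invFunOn f U, him ▸ differentiableOn_leftInverse_of_injOn hU hd hi hl, ?_, ?_,
    by rw [← hf0, hl hz₀]⟩
  · rw [← him]
    exact fun x hx y hy e => (Function.invFunOn_injOn_image f U) hx hy e
  · rw [← him]
    exact hl.image_image

end RiemannMapping

/-! ### Holomorphic linear differential equations on a disk -/

section LinearODE

open Metric

variable {E : Type*} [NormedAddCommGroup E] [NormedSpace ℂ E]

/-- Integration along the segment from 0 to z gains the factor |z| / (n + 1); iterated, this yields
the factorials that make the Picard series converge. -/
theorem norm_le_of_norm_deriv_le_mul_pow {T T' : ℂ → E} {r C : ℝ} {n : ℕ}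
    (hT : ∀ z ∈ ball (0 : ℂ) r, HasDerivAt T (T' z) z) (h0 : T 0 = 0)
    (hb : ∀ z ∈ ball (0 : ℂ) r, ‖T' z‖ ≤ C * ‖z‖ ^ n) {z : ℂ} (hz : z ∈ ball (0 : ℂ) r) :
    ‖T z‖ ≤ C * ‖z‖ ^ (n + 1) / (n + 1) := by
  have hmem : ∀ t ∈ Icc (0 : ℝ) 1, (t : ℂ) * z ∈ ball (0 : ℂ) r := by
    intro t ht
    rw [mem_ball_zero_iff] at hz ⊢
    rw [norm_mul, Complex.norm_real, Real.norm_of_nonneg ht.1]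
    exact (mul_le_of_le_one_left (norm_nonneg z) ht.2).trans_lt hz
  have hd : ∀ t ∈ Icc (0 : ℝ) 1,
      HasDerivAt (fun s : ℝ => T (s * z)) (z • T' (t * z)) t := by
    intro t ht
    have h1 : HasDerivAt (fun s : ℝ => (s : ℂ) * z) z t := by
      simpa using (Complex.ofRealCLM.hasDerivAt (x := t)).mul_const z
    exact (hT _ (hmem t ht)).scomp t h1
  have hn : ((n : ℝ) + 1) ≠ 0 := by positivity
  have key := image_norm_le_of_norm_deriv_right_le_deriv_boundary
    (f := fun s : ℝ => T (s * z)) (f' := fun t : ℝ => z • T' (t * z)) (a := 0) (b := 1)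
    (B := fun t => C * ‖z‖ ^ (n + 1) / (n + 1) * t ^ (n + 1))
    (B' := fun t => C * ‖z‖ ^ (n + 1) * t ^ n)
    (fun t ht => (hd t ht).continuousAt.continuousWithinAt)
    (fun t ht => (hd t ⟨ht.1, ht.2.le⟩).hasDerivWithinAt) (by simp [h0]) ?_ ?_
    (right_mem_Icc.2 zero_le_one)
  · simpa using key
  · intro t
    convert! (hasDerivAt_pow (n + 1) t).const_mul (C * ‖z‖ ^ (n + 1) / (n + 1)) using 1
    push_cast
    field_simp
  · intro t ht
    have h1 := hb _ (hmem t ⟨ht.1, ht.2.le⟩)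
    rw [norm_mul, Complex.norm_real, Real.norm_of_nonneg ht.1, mul_pow] at h1
    rw [norm_smul]
    calc ‖z‖ * ‖T' (t * z)‖ ≤ ‖z‖ * (C * (t ^ n * ‖z‖ ^ n)) := by gcongr
      _ = _ := by ring

variable [CompleteSpace E]

/-- Linear differential equations with holomorphic coefficients can be solved on a disk. -/
theorem exists_solution_linearODE_ball {A : ℂ → E →L[ℂ] E} {R : ℝ}
    (hA : DifferentiableOn ℂ A (ball 0 R)) (c : E) :
    ∃ W : ℂ → E, W 0 = c ∧ ∀ z ∈ ball (0 : ℂ) R, HasDerivAt W (A z (W z)) z := by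
  have hstep : ∀ T : ℂ → E, DifferentiableOn ℂ T (ball 0 R) →
      ∃ T' : ℂ → E, T' 0 = 0 ∧ ∀ z ∈ ball (0 : ℂ) R, HasDerivAt T' (A z (T z)) z := fun T hT =>
    (DifferentiableOn.isExactOn_ball (hA.clm_apply hT)).with_val_at 0 0
  choose! P hP0 hPd using hstep
  -- Terms of the Picard series: T 0 = c, and T (n + 1) is the primitive of A · T n vanishing at 0.
  -- The solution is their sum.
  set T : ℕ → ℂ → E := fun n => P^[n] fun _ => c with hTdef
  have hTs : ∀ n, T (n + 1) = P (T n) := fun n => Function.iterate_succ_apply' P n _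
  have hTd : ∀ n, DifferentiableOn ℂ (T n) (ball 0 R) := by
    intro n
    induction n with
    | zero => exact differentiableOn_const c
    | succ n ih =>
      rw [hTs]
      exact fun z hz => (hPd _ ih z hz).differentiableAt.differentiableWithinAt
  have hTd' : ∀ n, ∀ z ∈ ball (0 : ℂ) R, HasDerivAt (T (n + 1)) (A z (T n z)) z := by
    intro n
    rw [hTs]
    exact hPd _ (hTd n)
  have hT0 : ∀ n, T (n + 1) 0 = 0 := fun n => by rw [hTs]; exact hP0 _ (hTd n)
  refine ⟨fun z => ∑' n, T n z, ?_, fun z hz => ?_⟩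
  · change ∑' n, T n 0 = c
    rw [tsum_eq_single 0 (fun n hn => ?_)]
    · rfl
    · obtain ⟨m, rfl⟩ := Nat.exists_eq_succ_of_ne_zero hn
      exact hT0 m
  obtain ⟨r, hzr, hrR⟩ := exists_between (mem_ball_zero_iff.1 hz)
  have hr0 : 0 < r := (norm_nonneg z).trans_lt hzr
  obtain ⟨M, hM⟩ := (isCompact_closedBall (0 : ℂ) r).exists_bound_of_continuousOn
    (hA.continuousOn.mono (closedBall_subset_ball hrR))
  have hsub : ball (0 : ℂ) r ⊆ ball 0 R := ball_subset_ball hrR.le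
  have hM0 : 0 ≤ M := (norm_nonneg _).trans (hM 0 (mem_closedBall_self hr0.le))
  have hbound : ∀ n, ∀ w ∈ ball (0 : ℂ) r, ‖T n w‖ ≤ ‖c‖ * M ^ n / n.factorial * ‖w‖ ^ n := by
    intro n
    induction n with
    | zero => intro w _; simp [T]
    | succ n ih =>
      intro w hw
      have := norm_le_of_norm_deriv_le_mul_pow (n := n)
        (C := M * (‖c‖ * M ^ n / n.factorial)) (fun w hw => hTd' n w (hsub hw)) (hT0 n)
        (fun w hw => ?_) hw
      · refine this.trans (le_of_eq ?_)
        rw [Nat.factorial_succ]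
        push_cast
        field_simp
        ring
      · refine (ContinuousLinearMap.le_opNorm _ _).trans ?_
        rw [mul_assoc]
        gcongr
        · exact hM w (ball_subset_closedBall hw)
        · exact ih w hw
  have hsum : Summable fun n : ℕ => ‖c‖ * ((M * r) ^ n / n.factorial) :=
    (Real.summable_pow_div_factorial (M * r)).mul_left _
  have hle : ∀ n, ∀ w ∈ ball (0 : ℂ) r, ‖T n w‖ ≤ ‖c‖ * ((M * r) ^ n / n.factorial) := by
    intro n w hw
    refine (hbound n w hw).trans ?_
    have hwr := (mem_ball_zero_iff.1 hw).le
    calc ‖c‖ * M ^ n / n.factorial * ‖w‖ ^ n ≤ ‖c‖ * M ^ n / n.factorial * r ^ n := by gcongr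
      _ = _ := by rw [mul_pow]; ring
  have hzr' : z ∈ ball (0 : ℂ) r := mem_ball_zero_iff.2 hzr
  have hdiff := Complex.differentiableOn_tsum_of_summable_norm hsum
    (fun n => (hTd n).mono hsub) isOpen_ball hle
  have hder := Complex.hasSum_deriv_of_summable_norm hsum
    (fun n => (hTd n).mono hsub) isOpen_ball hle hzr'
  have hWz : HasSum (fun n => T n z) (∑' n, T n z) :=
    (Summable.of_norm_bounded hsum fun n => hle n z hzr').hasSum
  -- The constant term T 0 has derivative 0; dropping it, the differentiated series is A z applied
  -- to the series itself.
  have hder' : HasSum (fun n => deriv (T n) z) (A z (∑' n, T n z)) := by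
    rw [← hasSum_nat_add_iff' 1]
    have h0 : deriv (T 0) z = 0 := by simp [T]
    simp only [Finset.range_one, Finset.sum_singleton, h0, sub_zero]
    have := (A z).hasSum hWz
    refine this.congr_fun ?_
    intro n
    exact (hTd' n z hz).deriv
  have := (hdiff.differentiableAt (isOpen_ball.mem_nhds hzr')).hasDerivAt
  rwa [hder.unique hder'] at this

end LinearODE

/-! ### Prescribing the Schwarzian derivative by y'' + q y = 0 -/

section SchwarzianEquation

open Metric

/-- On a simply connected region `D ≠ ℂ` the equation `y'' + q y = 0` with holomorphic `q` has a
solution with prescribed initial values. Here `v` is the derivative of `y`. -/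
theorem exists_solution_secondOrder {D : Set ℂ} (hD : IsOpen D) (hs : IsSimplyConnected D)
    (hne : D ≠ univ) {q : ℂ → ℂ} (hq : DifferentiableOn ℂ q D) {z₀ : ℂ} (hz₀ : z₀ ∈ D) (c d : ℂ) :
    ∃ y v : ℂ → ℂ, y z₀ = c ∧ v z₀ = d ∧
      ∀ z ∈ D, HasDerivAt y (v z) z ∧ HasDerivAt v (-(q z * y z)) z := by
  obtain ⟨g, hgd, hgi, hgim, hg0⟩ := exists_riemannMap_of_ball hD hs hne hz₀
  have hgm : MapsTo g (ball 0 1) D := mapsTo_iff_image_subset.2 hgim.subset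
  have hl : LeftInvOn (Function.invFunOn g (ball 0 1)) g (ball 0 1) := hgi.leftInvOn_invFunOn
  set h := Function.invFunOn g (ball 0 1) with hh
  have hg' : DifferentiableOn ℂ (deriv g) (ball 0 1) := hgd.deriv isOpen_ball
  -- The equation pulled back by the Riemann map g: for W = (y ∘ g, v ∘ g) it is the first-order
  -- system W₁' = g' W₂, W₂' = -(q ∘ g) g' W₁.
  obtain ⟨W, hW0, hW⟩ := exists_solution_linearODE_ball (R := 1)
    (A := fun w => deriv g w •
        ((ContinuousLinearMap.inl ℂ ℂ ℂ).comp (ContinuousLinearMap.snd ℂ ℂ ℂ)) +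
      (-(q (g w)) * deriv g w) •
        ((ContinuousLinearMap.inr ℂ ℂ ℂ).comp (ContinuousLinearMap.fst ℂ ℂ ℂ)))
    ((hg'.smul_const _).add (((hq.comp hgd hgm).neg.mul hg').smul_const _)) (c, d)
  have hh0 : h z₀ = 0 := by rw [← hg0]; exact hl (mem_ball_self one_pos)
  refine ⟨fun z => (W (h z)).1, fun z => (W (h z)).2, by simp [hh0, hW0], by simp [hh0, hW0], ?_⟩
  intro z hz
  obtain ⟨w, hw, rfl⟩ := hgim.symm ▸ hz
  have hhd := (differentiableAt_leftInverse_of_injOn isOpen_ball hgd hgi hl hw).hasDerivAt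
  have hone := deriv_leftInverse_mul_deriv isOpen_ball hgd hgi hl hw
  have hWw := hW w hw
  rw [← hl hw] at hWw
  have hcomp := hWw.scomp (g w) hhd
  rw [hl hw] at hcomp
  constructor
  · convert! (hasFDerivAt_fst.comp_hasDerivAt (g w) hcomp) using 1
    simp only [hl hw]
    simp
    linear_combination -(W w).2 * hone
  · convert! (hasFDerivAt_snd.comp_hasDerivAt (g w) hcomp) using 1
    simp only [hl hw]
    simp
    linear_combination -(q (g w) * (W w).1) * hone

/-- Two solutions of `y'' + q y = 0` in `D`, with derivatives `v₁`, `v₂` and with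
Wronskian `k ≠ 0`. -/
structure IsSolutionPair (q : ℂ → ℂ) (D : Set ℂ) (y₁ v₁ y₂ v₂ : ℂ → ℂ) (k : ℂ) : Prop where
  isOpen : IsOpen D
  deriv_fst : ∀ z ∈ D, HasDerivAt y₁ (v₁ z) z
  deriv_deriv_fst : ∀ z ∈ D, HasDerivAt v₁ (-(q z * y₁ z)) z
  deriv_snd : ∀ z ∈ D, HasDerivAt y₂ (v₂ z) z
  deriv_deriv_snd : ∀ z ∈ D, HasDerivAt v₂ (-(q z * y₂ z)) z
  wronskian : ∀ z ∈ D, v₁ z * y₂ z - y₁ z * v₂ z = k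
  wronskian_ne_zero : k ≠ 0

theorem exists_isSolutionPair {D : Set ℂ} (hD : IsOpen D) (hs : IsSimplyConnected D)
    (hne : D ≠ univ) {q : ℂ → ℂ} (hq : DifferentiableOn ℂ q D) :
    ∃ y₁ v₁ y₂ v₂ : ℂ → ℂ, IsSolutionPair q D y₁ v₁ y₂ v₂ 1 := by
  obtain ⟨z₀, hz₀⟩ := hs.nonempty
  obtain ⟨y₁, v₁, hy₁, hv₁, h₁⟩ := exists_solution_secondOrder hD hs hne hq hz₀ 0 1
  obtain ⟨y₂, v₂, hy₂, hv₂, h₂⟩ := exists_solution_secondOrder hD hs hne hq hz₀ 1 0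
  refine ⟨y₁, v₁, y₂, v₂, hD, fun z hz => (h₁ z hz).1, fun z hz => (h₁ z hz).2,
    fun z hz => (h₂ z hz).1, fun z hz => (h₂ z hz).2, fun z hz => ?_, one_ne_zero⟩
  -- There is no first-order term, so the Wronskian is constant; the initial values (0, 1) and (1,
  -- 0) make it 1.
  have hd : ∀ z ∈ D, HasDerivAt (fun z => v₁ z * y₂ z - y₁ z * v₂ z) 0 z := by
    intro z hz
    convert! ((h₁ z hz).2.mul (h₂ z hz).1).sub ((h₁ z hz).1.mul (h₂ z hz).2) using 1
    ring
  have := hD.is_const_of_deriv_eq_zero hs.isPathConnected.isConnected.isPreconnected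
    (fun z hz => (hd z hz).differentiableAt.differentiableWithinAt)
    (fun z hz => (hd z hz).deriv) hz hz₀
  simpa [hy₁, hv₁, hy₂, hv₂] using this

theorem AnalyticAt.exists_injOn_of_deriv_ne_zero {f : ℂ → ℂ} {z : ℂ} (hf : AnalyticAt ℂ f z)
    (hd : deriv f z ≠ 0) : ∃ U ∈ 𝓝 z, InjOn f U := by
  have hs : HasStrictDerivAt f (deriv f z) z := hf.hasStrictDerivAt
  refine ⟨_, (hs.hasStrictFDerivAt_equiv hd).eventually_left_inverse, ?_⟩
  intro a ha b hb hab
  rw [mem_ofPred_eq] at ha hb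
  rw [← ha, ← hb, hab]

namespace IsSolutionPair

variable {q : ℂ → ℂ} {D : Set ℂ} {y₁ v₁ y₂ v₂ : ℂ → ℂ} {k : ℂ}

/-- Near a zero of y₂ everything is proved for y₂ / y₁ instead. -/
theorem swap (h : IsSolutionPair q D y₁ v₁ y₂ v₂ k) : IsSolutionPair q D y₂ v₂ y₁ v₁ (-k) :=
  ⟨h.isOpen, h.deriv_snd, h.deriv_deriv_snd, h.deriv_fst, h.deriv_deriv_fst,
    fun z hz => by rw [← h.wronskian z hz]; ring, neg_ne_zero.2 h.wronskian_ne_zero⟩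

theorem fst_ne_zero (h : IsSolutionPair q D y₁ v₁ y₂ v₂ k) {z : ℂ} (hz : z ∈ D) (h0 : y₂ z = 0) :
    y₁ z ≠ 0 := by
  intro h1
  apply h.wronskian_ne_zero
  rw [← h.wronskian z hz, h0, h1]
  ring

theorem eventually (h : IsSolutionPair q D y₁ v₁ y₂ v₂ k) {z : ℂ} (hz : z ∈ D) (h0 : y₂ z ≠ 0) :
    ∀ᶠ w in 𝓝 z, w ∈ D ∧ y₂ w ≠ 0 :=
  (h.isOpen.eventually_mem hz).and ((h.deriv_snd z hz).continuousAt.eventually_ne h0)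

theorem hasDerivAt_div (h : IsSolutionPair q D y₁ v₁ y₂ v₂ k) {z : ℂ} (hz : z ∈ D)
    (h0 : y₂ z ≠ 0) : HasDerivAt (fun w => y₁ w / y₂ w) (k / y₂ z ^ 2) z := by
  rw [← h.wronskian z hz]
  exact (h.deriv_fst z hz).div (h.deriv_snd z hz) h0

theorem analyticAt_div (h : IsSolutionPair q D y₁ v₁ y₂ v₂ k) {z : ℂ} (hz : z ∈ D)
    (h0 : y₂ z ≠ 0) : AnalyticAt ℂ (fun w => y₁ w / y₂ w) z := by
  rw [Complex.analyticAt_iff_eventually_differentiableAt]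
  filter_upwards [h.eventually hz h0] with w hw
  exact (h.hasDerivAt_div hw.1 hw.2).differentiableAt

theorem deriv_div_ne_zero (h : IsSolutionPair q D y₁ v₁ y₂ v₂ k) {z : ℂ} (hz : z ∈ D)
    (h0 : y₂ z ≠ 0) : deriv (fun w => y₁ w / y₂ w) z ≠ 0 := by
  rw [(h.hasDerivAt_div hz h0).deriv]
  exact div_ne_zero h.wronskian_ne_zero (pow_ne_zero 2 h0)

/-- From f' = k / y₂² the pre-Schwarzian is -2 v₂ / y₂; in T' - T² / 2 the squares of v₂ / y₂
cancel, and v₂' = -q y₂ leaves 2q. -/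
theorem analyticSchwarzian_div (h : IsSolutionPair q D y₁ v₁ y₂ v₂ k) {z : ℂ} (hz : z ∈ D)
    (h0 : y₂ z ≠ 0) : analyticSchwarzian (fun w => y₁ w / y₂ w) z = 2 * q z := by
  have hpre : ∀ w ∈ D, y₂ w ≠ 0 →
      preSchwarzian (fun w => y₁ w / y₂ w) w = -2 * v₂ w / y₂ w := by
    intro w hw hw0
    have hev : deriv (fun w => y₁ w / y₂ w) =ᶠ[𝓝 w] fun x => k / y₂ x ^ 2 := by
      filter_upwards [h.eventually hw hw0] with x hx
      exact (h.hasDerivAt_div hx.1 hx.2).deriv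
    have hd : HasDerivAt (fun x => k / y₂ x ^ 2)
        ((0 * y₂ w ^ 2 - k * (2 * y₂ w ^ 1 * v₂ w)) / (y₂ w ^ 2) ^ 2) w := by
      have := (hasDerivAt_const w k).div ((h.deriv_snd w hw).pow 2) (pow_ne_zero 2 hw0)
      exact_mod_cast this
    rw [preSchwarzian, hev.deriv_eq, hd.deriv, (h.hasDerivAt_div hw hw0).deriv]
    have hk := h.wronskian_ne_zero
    field_simp
    ring
  have hev : preSchwarzian (fun w => y₁ w / y₂ w) =ᶠ[𝓝 z] fun x => -2 * v₂ x / y₂ x := by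
    filter_upwards [h.eventually hz h0] with x hx using hpre x hx.1 hx.2
  have hd : HasDerivAt (fun x => -2 * v₂ x / y₂ x)
      ((-2 * (-(q z * y₂ z)) * y₂ z - -2 * v₂ z * v₂ z) / y₂ z ^ 2) z :=
    ((h.deriv_deriv_snd z hz).const_mul (-2)).div (h.deriv_snd z hz) h0
  rw [analyticSchwarzian, hev.deriv_eq, hd.deriv, hpre z hz h0]
  field_simp
  ring

theorem inv_div_eq : (fun w => y₁ w / y₂ w)⁻¹ = fun w => y₂ w / y₁ w := by
  ext w
  simp

/-- If y₁ / y₂ were analytic at z, its product with y₂ / y₁ would tend to 0 there, yet the product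
is 1 on a punctured neighbourhood. -/
theorem not_analyticAt_div (h : IsSolutionPair q D y₁ v₁ y₂ v₂ k) {z : ℂ} (hz : z ∈ D)
    (h0 : y₂ z = 0) : ¬ AnalyticAt ℂ (fun w => y₁ w / y₂ w) z := by
  intro ha
  have h1 := h.fst_ne_zero hz h0
  have hne : ∀ᶠ w in 𝓝[≠] z, y₂ w / y₁ w ≠ 0 := by
    have hd := h.swap.hasDerivAt_div hz h1
    have := hd.eventually_ne (c := 0)
      (div_ne_zero h.swap.wronskian_ne_zero (pow_ne_zero 2 h1))
    exact this
  have hlim := (ha.continuousAt.mul (h.swap.analyticAt_div hz h1).continuousAt).tendsto.mono_left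
    (nhdsWithin_le_nhds (s := {z}ᶜ))
  have hone : Tendsto (fun w => y₁ w / y₂ w * (y₂ w / y₁ w)) (𝓝[≠] z) (𝓝 1) := by
    refine tendsto_const_nhds.congr' ?_
    filter_upwards [hne] with w hw
    rw [← inv_div (y₂ w), inv_mul_cancel₀ hw]
  have := tendsto_nhds_unique hlim hone
  simp [h0] at this

theorem analyticAt_div_iff (h : IsSolutionPair q D y₁ v₁ y₂ v₂ k) {z : ℂ} (hz : z ∈ D) :
    AnalyticAt ℂ (fun w => y₁ w / y₂ w) z ↔ y₂ z ≠ 0 :=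
  ⟨fun ha h0 => h.not_analyticAt_div hz h0 ha, h.analyticAt_div hz⟩

theorem schwarzian_div (h : IsSolutionPair q D y₁ v₁ y₂ v₂ k) {z : ℂ} (hz : z ∈ D) :
    schwarzian (fun w => y₁ w / y₂ w) z = 2 * q z := by
  rw [schwarzian, h.analyticAt_div_iff hz]
  split_ifs with h0
  · exact h.analyticSchwarzian_div hz h0
  · rw [inv_div_eq]
    exact h.swap.analyticSchwarzian_div hz (h.fst_ne_zero hz (not_not.1 h0))

/-- The convention y₁ / 0 = 0 is exactly the normal-form value at a pole. -/
theorem meromorphicNFOn_div (h : IsSolutionPair q D y₁ v₁ y₂ v₂ k) :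
    MeromorphicNFOn (fun w => y₁ w / y₂ w) D := by
  intro z hz
  by_cases h0 : y₂ z = 0
  · rw [← meromorphicNFAt_inv, inv_div_eq]
    exact (h.swap.analyticAt_div hz (h.fst_ne_zero hz h0)).meromorphicNFAt
  · exact (h.analyticAt_div hz h0).meromorphicNFAt

theorem toSphere_div_of_ne_zero (h : IsSolutionPair q D y₁ v₁ y₂ v₂ k) {z : ℂ} (hz : z ∈ D)
    (h0 : y₂ z ≠ 0) : toSphere (fun w => y₁ w / y₂ w) z = ((y₁ z / y₂ z : ℂ) : OnePoint ℂ) :=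
  if_pos (h.analyticAt_div hz h0)

theorem toSphere_div_of_eq_zero (h : IsSolutionPair q D y₁ v₁ y₂ v₂ k) {z : ℂ} (hz : z ∈ D)
    (h0 : y₂ z = 0) : toSphere (fun w => y₁ w / y₂ w) z = OnePoint.infty :=
  if_neg (h.not_analyticAt_div hz h0)

/-- The nonzero derivative gives local injectivity of y₁ / y₂, or of y₂ / y₁ near a pole, where the
value 0 of the latter corresponds to ∞. -/
theorem isLocallyUnivalentMeromorphic_div (h : IsSolutionPair q D y₁ v₁ y₂ v₂ k) :
    IsLocallyUnivalentMeromorphic (fun w => y₁ w / y₂ w) D := by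
  refine ⟨h.meromorphicNFOn_div, fun z hz => ?_⟩
  by_cases h0 : y₂ z = 0
  · have h1 := h.fst_ne_zero hz h0
    obtain ⟨U, hU, hi⟩ := (h.swap.analyticAt_div hz h1).exists_injOn_of_deriv_ne_zero
      (h.swap.deriv_div_ne_zero hz h1)
    refine ⟨_, inter_mem hU (h.isOpen.mem_nhds hz), ?_⟩
    intro a ha b hb hab
    apply hi ha.1 hb.1
    change y₂ a / y₁ a = y₂ b / y₁ b
    by_cases ha0 : y₂ a = 0 <;> by_cases hb0 : y₂ b = 0
    · simp [ha0, hb0]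
    · rw [h.toSphere_div_of_eq_zero ha.2 ha0, h.toSphere_div_of_ne_zero hb.2 hb0] at hab
      exact (OnePoint.infty_ne_coe _ hab).elim
    · rw [h.toSphere_div_of_eq_zero hb.2 hb0, h.toSphere_div_of_ne_zero ha.2 ha0] at hab
      exact (OnePoint.coe_ne_infty _ hab).elim
    · rw [h.toSphere_div_of_ne_zero hb.2 hb0, h.toSphere_div_of_ne_zero ha.2 ha0,
        OnePoint.coe_eq_coe] at hab
      rw [← inv_div, hab, inv_div]
  · obtain ⟨U, hU, hi⟩ := (h.analyticAt_div hz h0).exists_injOn_of_deriv_ne_zero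
      (h.deriv_div_ne_zero hz h0)
    refine ⟨_, inter_mem hU (h.eventually hz h0), ?_⟩
    intro a ha b hb hab
    rw [h.toSphere_div_of_ne_zero ha.2.1 ha.2.2, h.toSphere_div_of_ne_zero hb.2.1 hb.2.2,
      OnePoint.coe_eq_coe] at hab
    exact hi ha.1 hb.1 hab

end IsSolutionPair

/-- Every holomorphic function on a simply connected region `D ≠ ℂ` is the Schwarzian derivative
of a locally univalent meromorphic function. -/
theorem exists_schwarzian_eq {D : Set ℂ} (hD : IsOpen D) (hs : IsSimplyConnected D)
    (hne : D ≠ univ) {φ : ℂ → ℂ} (hφ : DifferentiableOn ℂ φ D) :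
    ∃ f : ℂ → ℂ, IsLocallyUnivalentMeromorphic f D ∧ ∀ z ∈ D, schwarzian f z = φ z := by
  obtain ⟨y₁, v₁, y₂, v₂, h⟩ := exists_isSolutionPair hD hs hne
    (q := fun z => φ z / 2) (hφ.div_const 2)
  refine ⟨_, h.isLocallyUnivalentMeromorphic_div, fun z hz => ?_⟩
  rw [h.schwarzian_div hz]
  ring

end SchwarzianEquation

/-! ### The area theorem -/

section AreaTheorem

open Metric ComplexConjugate MeasureTheory

/-- The maximum principle for the complex harmonic functions `α f + β conj f`. -/
theorem norm_mul_add_mul_conj_le_of_forall_mem_frontier {U : Set ℂ} (hU : Bornology.IsBounded U)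
    {f : ℂ → ℂ} (hf : DiffContOnCl ℂ f U) (α β : ℂ) {K : ℝ} (hK0 : 0 ≤ K)
    (hK : ∀ z ∈ frontier U, ‖α * f z + β * conj (f z)‖ ≤ K) {z : ℂ} (hz : z ∈ closure U) :
    ‖α * f z + β * conj (f z)‖ ≤ K := by
  -- The real part of e (α f + β conj f) is that of a multiple of f. Taking e = conj X, with X the
  -- value at z, the exponential of this multiple is holomorphic and the usual maximum principle
  -- applies to it.
  have hre : ∀ e w : ℂ, ((e * α + conj (e * β)) * w).re = (e * (α * w + β * conj w)).re := by
    intro e w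
    simp
    ring
  set X := α * f z + β * conj (f z) with hX
  rcases eq_or_ne X 0 with h0 | h0
  · rwa [h0, norm_zero]
  · have hd : DiffContOnCl ℂ
        (fun w => Complex.exp ((conj X * α + conj (conj X * β)) * f w)) U :=
      Complex.differentiable_exp.comp_diffContOnCl (hf.const_smul (conj X * α + conj (conj X * β)))
    have key := Complex.norm_le_of_forall_mem_frontier_norm_le hU hd
      (C := Real.exp (‖X‖ * K)) (fun w hw => ?_) hz
    · rw [Complex.norm_exp, hre, Real.exp_le_exp, ← hX, mul_comm, Complex.mul_conj,
        Complex.ofReal_re, Complex.normSq_eq_norm_sq, sq] at key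
      exact le_of_mul_le_mul_left key (norm_pos_iff.2 h0)
    · rw [Complex.norm_exp, hre, Real.exp_le_exp]
      refine (Complex.re_le_norm _).trans ?_
      rw [norm_mul, RCLike.norm_conj]
      exact mul_le_mul_of_nonneg_left (hK w hw) (norm_nonneg X)

theorem det_smul_add_smul_conj (L : ℂ →ₗ[ℝ] ℂ) {α β : ℂ} (hL : ∀ w, L w = α * w + β * conj w) :
    LinearMap.det L = ‖α‖ ^ 2 - ‖β‖ ^ 2 := by
  rw [← LinearMap.det_toMatrix Complex.basisOneI, Matrix.det_fin_two]
  simp only [LinearMap.toMatrix_apply, Complex.coe_basisOneI, Complex.coe_basisOneI_repr, hL,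
    Complex.sq_norm, Complex.normSq_apply]
  simp
  ring

theorem volume_image_eq_lintegral_norm_deriv_sq {f : ℂ → ℂ} {s : Set ℂ} (hs : IsOpen s)
    (hf : DifferentiableOn ℂ f s) (hi : InjOn f s) :
    volume (f '' s) = ∫⁻ z in s, ENNReal.ofReal (‖deriv f z‖ ^ 2) := by
  rw [← lintegral_abs_det_fderiv_eq_addHaar_image volume hs.measurableSet
    (f' := fun z => (fderiv ℂ f z).restrictScalars ℝ) (fun z hz =>
      ((hf.differentiableAt (hs.mem_nhds hz)).hasFDerivAt.restrictScalars ℝ).hasFDerivWithinAt) hi]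
  refine lintegral_congr fun z => ?_
  congr 1
  rw [ContinuousLinearMap.det, det_smul_add_smul_conj (α := deriv f z) (β := 0)]
  · simp
  · intro w
    simp [mul_comm w]

theorem volume_image_smul_add_smul_conj (s : Set ℂ) (α β : ℂ) :
    volume ((fun w => α * w + β * conj w) '' s) =
      ENNReal.ofReal |‖α‖ ^ 2 - ‖β‖ ^ 2| * volume s := by
  let L : ℂ →ₗ[ℝ] ℂ := α • LinearMap.id + β • Complex.conjLIE.toLinearMap
  have hL : ∀ w, L w = α * w + β * conj w := fun w => rfl
  rw [← det_smul_add_smul_conj L hL, ← Measure.addHaar_image_linearMap]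
  rfl

/-- A lower bound for the quadratic mean of `-1 / z ^ 2 + k z`. -/
theorem le_circleAverage_norm_sq {k : ℂ → ℂ} (hk : DifferentiableOn ℂ k (ball 0 1)) {s : ℝ}
    (hs0 : 0 < s) (hs1 : s < 1) :
    (s ^ 4)⁻¹ + ‖k 0‖ ^ 2 ≤ Real.circleAverage (fun z => ‖-(z ^ 2)⁻¹ + k z‖ ^ 2) 0 s := by
  set b := k 0 with hb
  -- Chosen so that on |z| = s, where 1 / z² = conj z² / s⁴, the integrand equals s⁻⁴ + |b|² + |k z
  -- - b|² + Re H. Since H is holomorphic with H 0 = 0, Re H averages to 0.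
  set H : ℂ → ℂ := fun z =>
    2 * (k z - b) * (-z ^ 2 / s ^ 4 + conj b) - 2 * b * z ^ 2 / s ^ 4 with hH
  have hsub : closedBall (0 : ℂ) s ⊆ ball 0 1 := closedBall_subset_ball hs1
  have hHd : DifferentiableOn ℂ H (ball 0 1) := by
    have : DifferentiableOn ℂ (fun z : ℂ => z ^ 2) (ball 0 1) := differentiableOn_id.pow 2
    exact (((hk.sub_const b).const_mul 2).mul ((this.neg.div_const _).add_const _)).sub
      ((this.const_mul (2 * b)).div_const _)
  have hHm : Real.circleAverage H 0 s = 0 := by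
    rw [DiffContOnCl.circleAverage]
    · simp [H, hb]
    · rw [abs_of_pos hs0]
      refine DifferentiableOn.diffContOnCl ?_
      rw [closure_ball _ hs0.ne']
      exact hHd.mono hsub
  have hsph : sphere (0 : ℂ) |s| ⊆ ball 0 1 := by
    rw [abs_of_pos hs0]
    exact sphere_subset_closedBall.trans hsub
  have hsph0 : ∀ z ∈ sphere (0 : ℂ) |s|, z ≠ 0 := by
    rintro z hz rfl
    rw [abs_of_pos hs0] at hz
    simp at hz
    linarith
  have hHi : CircleIntegrable H 0 s := (hHd.continuousOn.mono hsph).circleIntegrable'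
  have hre : Real.circleAverage (fun z => (H z).re) 0 s = 0 := by
    have := Complex.reCLM.circleAverage_comp_comm hHi
    rwa [hHm, map_zero] at this
  have hreI : CircleIntegrable (fun z => (H z).re) 0 s :=
    (Complex.continuous_re.comp_continuousOn (hHd.continuousOn.mono hsph)).circleIntegrable'
  have h1 : Real.circleAverage (fun z => ((s ^ 4)⁻¹ + ‖b‖ ^ 2) + (H z).re) 0 s =
      (s ^ 4)⁻¹ + ‖b‖ ^ 2 := by
    have := Real.circleAverage_add (circleIntegrable_const ((s ^ 4)⁻¹ + ‖b‖ ^ 2) 0 s) hreI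
    rw [hre, Real.circleAverage_const, add_zero] at this
    exact this
  rw [← h1]
  refine Real.circleAverage_mono ((circleIntegrable_const _ 0 s).add hreI) ?_ ?_
  · refine ContinuousOn.circleIntegrable' ?_
    exact ((((continuousOn_id.pow 2).inv₀ fun z hz => pow_ne_zero 2 (hsph0 z hz)).neg.add
      (hk.continuousOn.mono hsph)).norm.pow 2)
  · intro z hz
    have hz0 := hsph0 z hz
    have hzs : z * conj z = (s : ℂ) ^ 2 := by
      rw [Complex.mul_conj, Complex.normSq_eq_norm_sq]
      have : ‖z‖ = s := by rw [← abs_of_pos hs0]; simpa using hz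
      rw [this]
      push_cast
      rfl
    have hs0' : (s : ℂ) ≠ 0 := by exact_mod_cast hs0.ne'
    have hinv : (z ^ 2)⁻¹ = conj z ^ 2 / s ^ 4 := by
      rw [eq_div_iff (pow_ne_zero 4 hs0'), inv_mul_eq_iff_eq_mul₀ (pow_ne_zero 2 hz0)]
      linear_combination -(z * conj z + s ^ 2) * hzs
    set q := k z - b with hq
    have hkz : k z = q + b := by rw [hq]; ring
    set u := z ^ 2 / (s : ℂ) ^ 4 with hu
    have hucj : conj z ^ 2 / (s : ℂ) ^ 4 = conj u := by
      rw [hu]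
      simp
    have hHz : H z = 2 * q * (-u + conj b) - 2 * b * u := by
      simp only [H, hu]
      ring
    have hun : u.re ^ 2 + u.im ^ 2 = (s ^ 4)⁻¹ := by
      have h2 : u * conj u = ((s ^ 4)⁻¹ : ℝ) := by
        rw [← hucj, hu]
        push_cast
        rw [div_mul_div_comm, ← mul_pow, hzs]
        field_simp
      have h3 := congrArg Complex.re h2
      rw [Complex.mul_conj, Complex.ofReal_re, Complex.ofReal_re, Complex.normSq_apply] at h3
      rw [← h3]
      ring
    rw [hinv, hucj, hkz, hHz, ← hun]
    simp only [Complex.sq_norm, Complex.normSq_apply]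
    simp
    nlinarith [sq_nonneg q.re, sq_nonneg q.im]

theorem isOpen_annulus (ρ r : ℝ) : IsOpen {z : ℂ | ρ < ‖z‖ ∧ ‖z‖ < r} :=
  (isOpen_lt continuous_const continuous_norm).inter (isOpen_lt continuous_norm continuous_const)

theorem closure_annulus_subset (ρ r : ℝ) :
    closure {z : ℂ | ρ < ‖z‖ ∧ ‖z‖ < r} ⊆ {z | ρ ≤ ‖z‖ ∧ ‖z‖ ≤ r} :=
  closure_minimal (fun _ hz => ⟨hz.1.le, hz.2.le⟩)
    ((isClosed_le continuous_const continuous_norm).inter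
      (isClosed_le continuous_norm continuous_const))

theorem frontier_annulus_subset (ρ r : ℝ) :
    frontier {z : ℂ | ρ < ‖z‖ ∧ ‖z‖ < r} ⊆ {z | ‖z‖ = ρ ∨ ‖z‖ = r} := by
  intro z hz
  rw [(isOpen_annulus ρ r).frontier_eq] at hz
  obtain ⟨h1, h2⟩ := closure_annulus_subset ρ r hz.1
  by_contra h
  rw [mem_ofPred_eq, not_or] at h
  exact hz.2 ⟨lt_of_le_of_ne h1 (Ne.symm h.1), lt_of_le_of_ne h2 h.2⟩

theorem lintegral_circleMap_eq_lintegral {f : ℂ → ENNReal} (hf : Measurable f) :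
    ∫⁻ s in Ioi (0 : ℝ), ENNReal.ofReal s * ∫⁻ θ in Ioc (-Real.pi) Real.pi, f (circleMap 0 s θ) =
      ∫⁻ z, f z := by
  rw [← Complex.lintegral_comp_polarCoord_symm]
  have hsymm : ∀ p : ℝ × ℝ, Complex.polarCoord.symm p = circleMap 0 p.1 p.2 := by
    intro p
    rw [Complex.polarCoord_symm_apply, circleMap_zero, Complex.exp_mul_I,
      Complex.ofReal_cos, Complex.ofReal_sin]
  have hmeas : Measurable fun p : ℝ × ℝ => circleMap 0 p.1 p.2 := by
    unfold circleMap
    fun_prop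
  simp only [hsymm, smul_eq_mul]
  rw [polarCoord_target, Measure.volume_eq_prod, ← Measure.prod_restrict, lintegral_prod]
  · refine lintegral_congr fun s => ?_
    dsimp only
    rw [lintegral_const_mul, restrict_Ioo_eq_restrict_Ioc]
    exact hf.comp (hmeas.comp measurable_prodMk_left)
  · exact ((ENNReal.measurable_ofReal.comp measurable_fst).mul (hf.comp hmeas)).aemeasurable

theorem ofReal_circleAverage_eq_lintegral {u : ℂ → ℝ} {s : ℝ} (hu : ContinuousOn u (sphere 0 |s|))
    (h0 : ∀ z, 0 ≤ u z) :
    ENNReal.ofReal (2 * Real.pi * Real.circleAverage u 0 s) =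
      ∫⁻ θ in Ioc (-Real.pi) Real.pi, ENNReal.ofReal (u (circleMap 0 s θ)) := by
  have hc : Continuous fun θ => u (circleMap 0 s θ) :=
    hu.comp_continuous (continuous_circleMap 0 s) fun θ => circleMap_mem_sphere' 0 s θ
  have hper : Function.Periodic (fun θ => u (circleMap 0 s θ)) (2 * Real.pi) :=
    (periodic_circleMap 0 s).comp u
  rw [← ofReal_integral_eq_lintegral_ofReal
    ((hc.integrableOn_Icc (a := -Real.pi) (b := Real.pi)).mono_set Ioc_subset_Icc_self)
    (Filter.Eventually.of_forall fun θ => h0 _)]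
  congr 1
  rw [← intervalIntegral.integral_of_le (by linarith [Real.pi_pos]), Real.circleAverage_def,
    smul_eq_mul, mul_inv_cancel_left₀ (by positivity)]
  have := hper.intervalIntegral_add_eq 0 (-Real.pi)
  rw [zero_add, show -Real.pi + 2 * Real.pi = Real.pi by ring] at this
  exact this

/-- A lower bound for the area of the image of an annulus under `1 / z + h z`, where `h' = k`. -/
theorem le_lintegral_annulus_norm_sq {k : ℂ → ℂ} (hk : DifferentiableOn ℂ k (ball 0 1)) {ρ r : ℝ}
    (hρ : 0 < ρ) (hρr : ρ < r) (hr : r < 1) :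
    ENNReal.ofReal (Real.pi * ((ρ ^ 2)⁻¹ - (r ^ 2)⁻¹ + ‖k 0‖ ^ 2 * (r ^ 2 - ρ ^ 2))) ≤
      ∫⁻ z in {z : ℂ | ρ < ‖z‖ ∧ ‖z‖ < r}, ENNReal.ofReal (‖-(z ^ 2)⁻¹ + k z‖ ^ 2) := by
  set A := {z : ℂ | ρ < ‖z‖ ∧ ‖z‖ < r} with hA
  set u : ℂ → ℝ := fun z => ‖-(z ^ 2)⁻¹ + k z‖ ^ 2 with hu
  have hcont : ContinuousOn u {z : ℂ | 0 < ‖z‖ ∧ ‖z‖ < 1} := by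
    refine ((((continuousOn_id.pow 2).inv₀ fun z hz => pow_ne_zero 2 (norm_pos_iff.1 hz.1)).neg.add
      (hk.continuousOn.mono fun z hz => mem_ball_zero_iff.2 hz.2)).norm.pow 2)
  have hAm : MeasurableSet A := (isOpen_annulus ρ r).measurableSet
  have hcA : ContinuousOn (fun z => ENNReal.ofReal (u z)) A :=
    ENNReal.continuous_ofReal.comp_continuousOn
      (hcont.mono fun z hz => ⟨hρ.trans hz.1, hz.2.trans hr⟩)
  have hmeas : Measurable (A.indicator fun z => ENNReal.ofReal (u z)) := by
    classical
    rw [← piecewise_eq_indicator]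
    exact hcA.measurable_piecewise continuousOn_const hAm
  rw [← lintegral_indicator hAm, ← lintegral_circleMap_eq_lintegral hmeas]
  have hsub : Ioc ρ r ⊆ Ioi 0 := fun s hs => hρ.trans hs.1
  refine le_trans ?_ (lintegral_mono_set hsub)
  rw [← restrict_Ioo_eq_restrict_Ioc]
  -- The circle bound 2π (s⁻⁴ + |k 0|²) times the polar weight s.
  set g : ℝ → ℝ := fun s => Real.pi * (2 * (s ^ 3)⁻¹ + 2 * ‖k 0‖ ^ 2 * s) with hg
  have hint : ENNReal.ofReal (Real.pi * ((ρ ^ 2)⁻¹ - (r ^ 2)⁻¹ + ‖k 0‖ ^ 2 * (r ^ 2 - ρ ^ 2))) =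
      ∫⁻ s in Ioo ρ r, ENNReal.ofReal (g s) := by
    have hgc : ContinuousOn g (uIcc ρ r) := by
      rw [uIcc_of_le hρr.le]
      have : ∀ s ∈ Icc ρ r, s ^ 3 ≠ 0 := fun s hs => pow_ne_zero 3 (hρ.trans_le hs.1).ne'
      exact continuousOn_const.mul ((continuousOn_const.mul ((continuousOn_id.pow 3).inv₀ this)).add
        (continuousOn_const.mul continuousOn_id))
    rw [restrict_Ioo_eq_restrict_Ioc, ← ofReal_integral_eq_lintegral_ofReal,
      ← intervalIntegral.integral_of_le hρr.le]
    · congr 1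
      rw [intervalIntegral.integral_eq_sub_of_hasDerivAt
        (f := fun s => Real.pi * (-(s ^ 2)⁻¹ + ‖k 0‖ ^ 2 * s ^ 2)) _ hgc.intervalIntegrable]
      · ring
      · intro s hs
        rw [uIcc_of_le hρr.le] at hs
        have hs0 : s ≠ 0 := (hρ.trans_le hs.1).ne'
        convert! ((((hasDerivAt_pow 2 s).inv (pow_ne_zero 2 hs0)).neg).add
          ((hasDerivAt_pow 2 s).const_mul (‖k 0‖ ^ 2))).const_mul Real.pi using 1
        simp only [g]
        field_simp
        push_cast
        ring
    · rw [uIcc_of_le hρr.le] at hgc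
      exact (hgc.integrableOn_Icc).mono_set Ioc_subset_Icc_self
    · filter_upwards [ae_restrict_mem measurableSet_Ioc] with s hs
      have hs0 : 0 < s := hρ.trans hs.1
      simp only [g, Pi.zero_apply]
      positivity
  rw [hint]
  refine setLIntegral_mono_ae' measurableSet_Ioo (Filter.Eventually.of_forall fun s hs => ?_)
  have hs0 : 0 < s := hρ.trans hs.1
  have hs1 : s < 1 := hs.2.trans hr
  have hind : ∀ θ, A.indicator (fun z => ENNReal.ofReal (u z)) (circleMap 0 s θ) =
      ENNReal.ofReal (u (circleMap 0 s θ)) := by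
    intro θ
    refine indicator_of_mem ?_ _
    have : ‖circleMap 0 s θ‖ = s := by simp [abs_of_pos hs0]
    rw [hA, mem_ofPred_eq, this]
    exact hs
  simp only [hind]
  rw [← ofReal_circleAverage_eq_lintegral (hcont.mono ?_) (fun z => by positivity),
    ← ENNReal.ofReal_mul hs0.le]
  · refine ENNReal.ofReal_le_ofReal ?_
    have := le_circleAverage_norm_sq hk hs0 hs1
    calc g s = s * (2 * Real.pi * ((s ^ 4)⁻¹ + ‖k 0‖ ^ 2)) := by
          simp only [g]
          field_simp
      _ ≤ _ := by gcongr
  · intro z hz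
    have : ‖z‖ = s := by rw [← abs_of_pos hs0]; simpa using hz
    rw [mem_ofPred_eq, this]
    exact ⟨hs0, hs1⟩

theorem exists_eq_add_mul_add_sq_mul {h : ℂ → ℂ} (hh : DifferentiableOn ℂ h (ball 0 1)) :
    ∃ k : ℂ → ℂ, DifferentiableOn ℂ k (ball 0 1) ∧
      ∀ z, h z = h 0 + deriv h 0 * z + z ^ 2 * k z := by
  have hn : ball (0 : ℂ) 1 ∈ 𝓝 0 := ball_mem_nhds 0 one_pos
  refine ⟨dslope (dslope h 0) 0, (Complex.differentiableOn_dslope hn).2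
    ((Complex.differentiableOn_dslope hn).2 hh), fun z => ?_⟩
  have h1 := sub_smul_dslope h 0 z
  have h2 := sub_smul_dslope (dslope h 0) 0 z
  rw [dslope_same] at h2
  simp only [sub_zero, smul_eq_mul] at h1 h2
  linear_combination -h1 - z * h2

/-- For small `ρ` the image of the circle `‖z‖ = ρ` under `1 / z + h z` is nearly an ellipse, and
this ellipse bounds the image of the annulus `ρ < ‖z‖ < r`. -/
theorem exists_forall_norm_sub_mul_conj_le {h : ℂ → ℂ} (hh : DifferentiableOn ℂ h (ball 0 1))
    {r : ℝ} (hr0 : 0 < r) (hr : r < 1) :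
    ∃ C : ℝ, ∀ᶠ ρ : ℝ in 𝓝[>] 0, ∀ z : ℂ, ρ < ‖z‖ → ‖z‖ < r →
      ‖1 * (z⁻¹ + h z - h 0) + (-(deriv h 0 * ρ ^ 2)) * conj (z⁻¹ + h z - h 0)‖ ≤
        ρ⁻¹ + C * ρ ^ 2 := by
  obtain ⟨k, hk, hkeq⟩ := exists_eq_add_mul_add_sq_mul hh
  set b := deriv h 0 with hb
  obtain ⟨C, hC⟩ := (isCompact_closedBall (0 : ℂ) r).exists_bound_of_continuousOn
    (hk.continuousOn.mono (closedBall_subset_ball hr))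
  obtain ⟨M, hM⟩ := (isCompact_closedBall (0 : ℂ) r).exists_bound_of_continuousOn
    ((hh.continuousOn.mono (closedBall_subset_ball hr)).sub continuousOn_const (g := fun _ => h 0))
  have hC0 : 0 ≤ C := (norm_nonneg _).trans (hC 0 (mem_closedBall_self hr0.le))
  have hM0 : 0 ≤ M := (norm_nonneg _).trans (hM 0 (mem_closedBall_self hr0.le))
  -- K bounds the expression on the outer circle; for ρ ≤ 1 / K it is at most 1 / ρ there, so only
  -- the inner circle matters.
  set K := (1 + ‖b‖) * (r⁻¹ + M) with hK
  have hK0 : 0 < K := by positivity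
  refine ⟨C + ‖b‖ ^ 2 + ‖b‖ * C, ?_⟩
  filter_upwards [Ioo_mem_nhdsGT (lt_min hr0 (inv_pos.2 hK0))] with ρ hρ z hz1 hz2
  have hρ0 : 0 < ρ := hρ.1
  have hρr : ρ < r := hρ.2.trans_le (min_le_left _ _)
  have hρ1 : ρ < 1 := hρr.trans hr
  have hρK : K ≤ ρ⁻¹ := by
    rw [le_inv_comm₀ hK0 hρ0]
    exact (hρ.2.trans_le (min_le_right _ _)).le
  refine norm_mul_add_mul_conj_le_of_forall_mem_frontier (f := fun z => z⁻¹ + h z - h 0)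
    (U := {z : ℂ | ρ < ‖z‖ ∧ ‖z‖ < r}) ?_ ?_ 1 _ (by positivity) ?_ (subset_closure ⟨hz1, hz2⟩)
  · exact isBounded_ball.subset fun z hz => mem_ball_zero_iff.2 hz.2
  · refine DifferentiableOn.diffContOnCl ?_
    refine DifferentiableOn.mono (t := {z : ℂ | ρ ≤ ‖z‖ ∧ ‖z‖ ≤ r}) ?_ (closure_annulus_subset ρ r)
    refine ((differentiableOn_id.inv fun z hz => ?_).add (hh.mono fun z hz => ?_)).sub_const _
    · exact norm_pos_iff.1 (hρ0.trans_le hz.1)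
    · exact mem_ball_zero_iff.2 (hz.2.trans_lt hr)
  · intro z hz
    obtain hzρ | hzr := frontier_annulus_subset ρ r hz
    · have hz0 : z ≠ 0 := norm_pos_iff.1 (hzρ ▸ hρ0)
      have hkz : ‖k z‖ ≤ C := hC z (mem_closedBall_zero_iff.2 (hzρ.le.trans hρr.le))
      have hinv : (ρ : ℂ) ^ 2 * conj z⁻¹ = z := by
        have h1 : z * conj z = (ρ : ℂ) ^ 2 := by
          rw [Complex.mul_conj, Complex.normSq_eq_norm_sq, hzρ]
          push_cast
          rfl
        rw [← h1, mul_assoc, ← map_mul, mul_inv_cancel₀ hz0, map_one, mul_one]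
      have heq : 1 * (z⁻¹ + h z - h 0) + (-(b * ρ ^ 2)) * conj (z⁻¹ + h z - h 0) =
          z⁻¹ + (z ^ 2 * k z - b * ρ ^ 2 * conj (b * z) - b * ρ ^ 2 * conj (z ^ 2 * k z)) := by
        have h2 : z⁻¹ + h z - h 0 = z⁻¹ + b * z + z ^ 2 * k z := by rw [hkeq z]; ring
        rw [h2, map_add, map_add]
        linear_combination -b * hinv
      rw [heq]
      calc ‖z⁻¹ + (z ^ 2 * k z - b * ρ ^ 2 * conj (b * z) - b * ρ ^ 2 * conj (z ^ 2 * k z))‖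
          ≤ ‖z⁻¹‖ + (‖z ^ 2 * k z‖ + ‖b * ρ ^ 2 * conj (b * z)‖ +
            ‖b * ρ ^ 2 * conj (z ^ 2 * k z)‖) :=
            (norm_add_le _ _).trans (add_le_add_right
              ((norm_sub_le _ _).trans (add_le_add_left (norm_sub_le _ _) _)) _)
        _ = ρ⁻¹ + (‖k z‖ + ‖b‖ ^ 2 * ρ + ‖b‖ * ‖k z‖ * ρ ^ 2) * ρ ^ 2 := by
            simp only [norm_mul, norm_inv, norm_pow, RCLike.norm_conj, hzρ, Complex.norm_real,
              Real.norm_of_nonneg hρ0.le]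
            ring
        _ ≤ ρ⁻¹ + (C + ‖b‖ ^ 2 * 1 + ‖b‖ * C * 1) * ρ ^ 2 := by
            have : ρ ^ 2 ≤ 1 := by nlinarith
            gcongr
        _ = _ := by ring
    · have hzM : ‖z⁻¹ + h z - h 0‖ ≤ r⁻¹ + M := by
        rw [add_sub_assoc]
        refine (norm_add_le _ _).trans (add_le_add (by rw [norm_inv, hzr]) ?_)
        exact hM z (mem_closedBall_zero_iff.2 hzr.le)
      calc ‖1 * (z⁻¹ + h z - h 0) + (-(b * ρ ^ 2)) * conj (z⁻¹ + h z - h 0)‖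
          ≤ ‖z⁻¹ + h z - h 0‖ + ‖b‖ * ρ ^ 2 * ‖z⁻¹ + h z - h 0‖ := by
            refine (norm_add_le _ _).trans (le_of_eq ?_)
            simp only [norm_mul, norm_neg, norm_pow, RCLike.norm_conj, Complex.norm_real,
              Real.norm_of_nonneg hρ0.le, one_mul]
        _ ≤ (r⁻¹ + M) + ‖b‖ * 1 * (r⁻¹ + M) := by
            have : ρ ^ 2 ≤ 1 := by nlinarith
            gcongr
        _ = K := by rw [hK]; ring
        _ ≤ ρ⁻¹ := hρK
        _ ≤ _ := le_add_of_nonneg_right (by positivity)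

/-- A consequence of the **area theorem**: if `1 / z + h z` is univalent in the punctured unit
disk, where `h` is holomorphic in the unit disk, then `|h' 0| ≤ 1`. -/
theorem norm_deriv_le_one_of_injOn_inv_add {h : ℂ → ℂ} (hh : DifferentiableOn ℂ h (ball 0 1))
    (hi : InjOn (fun z => z⁻¹ + h z) (ball 0 1 \ {0})) : ‖deriv h 0‖ ≤ 1 := by
  set b := deriv h 0 with hb
  have hk : DifferentiableOn ℂ (deriv h) (ball 0 1) := hh.deriv isOpen_ball
  -- Compare areas. After w ↦ w - bρ² conj w, of determinant 1 - |b|²ρ⁴, the image of the annulus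
  -- lies in a disk of radius 1 / ρ + Cρ². The terms ρ⁻² cancel, and ρ → 0 gives the bound.
  -- Enclosing the uncorrected image in a disk of radius 1 / ρ + |b|ρ would leave an extra 2|b|.
  have main : ∀ r : ℝ, 0 < r → r < 1 → ‖b‖ ^ 2 * r ^ 2 ≤ (r ^ 2)⁻¹ := by
    intro r hr0 hr
    obtain ⟨C, hC⟩ := exists_forall_norm_sub_mul_conj_le hh hr0 hr
    have hsmall : ∀ᶠ ρ : ℝ in 𝓝[>] 0, ‖b‖ ^ 2 * ρ ^ 4 < 1 := by
      refine nhdsWithin_le_nhds ?_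
      have : Tendsto (fun ρ : ℝ => ‖b‖ ^ 2 * ρ ^ 4) (𝓝 0) (𝓝 (‖b‖ ^ 2 * 0 ^ 4)) :=
        ((continuous_pow 4).const_mul _).tendsto' 0 _ rfl
      exact this.eventually_lt_const (by norm_num)
    have hpos : ∀ᶠ ρ : ℝ in 𝓝[>] 0, 0 ≤ ρ⁻¹ + C * ρ ^ 2 := by
      filter_upwards [hC, Ioo_mem_nhdsGT hr0] with ρ hρ hρ'
      obtain ⟨t, ht1, ht2⟩ := exists_between hρ'.2
      have ht : ‖(t : ℂ)‖ = t := by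
        rw [Complex.norm_real, Real.norm_of_nonneg (hρ'.1.trans ht1).le]
      exact (norm_nonneg _).trans (hρ t (by rwa [ht]) (by rwa [ht]))
    have key : ∀ᶠ ρ : ℝ in 𝓝[>] 0,
        -(r ^ 2)⁻¹ + ‖b‖ ^ 2 * (r ^ 2 - ρ ^ 2) - ‖b‖ ^ 2 * ρ ^ 2 -
          ‖b‖ ^ 2 * ρ ^ 4 * (-(r ^ 2)⁻¹ + ‖b‖ ^ 2 * (r ^ 2 - ρ ^ 2)) - 2 * C * ρ - C ^ 2 * ρ ^ 4
            ≤ 0 := by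
      filter_upwards [hC, hsmall, hpos, Ioo_mem_nhdsGT hr0] with ρ hρC hρs hρp hρ
      have hρ0 : 0 < ρ := hρ.1
      set A := {z : ℂ | ρ < ‖z‖ ∧ ‖z‖ < r} with hA
      set F : ℂ → ℂ := fun z => z⁻¹ + h z - h 0 with hF
      have hA0 : ∀ z ∈ A, z ≠ 0 := fun z hz => norm_pos_iff.1 (hρ0.trans hz.1)
      have hA1 : A ⊆ ball 0 1 := fun z hz => mem_ball_zero_iff.2 (hz.2.trans hr)
      have hFd : ∀ z ∈ A, HasDerivAt F (-(z ^ 2)⁻¹ + deriv h z) z := fun z hz =>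
        ((hasDerivAt_inv (hA0 z hz)).add
          (hh.differentiableAt (isOpen_ball.mem_nhds (hA1 hz))).hasDerivAt).sub_const _
      have hFi : InjOn F A := fun x hx y hy e =>
        hi ⟨hA1 hx, hA0 x hx⟩ ⟨hA1 hy, hA0 y hy⟩ (sub_left_injective e)
      have hvol : volume (F '' A) =
          ∫⁻ z in A, ENNReal.ofReal (‖-(z ^ 2)⁻¹ + deriv h z‖ ^ 2) := by
        rw [volume_image_eq_lintegral_norm_deriv_sq (isOpen_annulus ρ r)
          (fun z hz => (hFd z hz).differentiableAt.differentiableWithinAt) hFi]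
        refine setLIntegral_congr_fun (isOpen_annulus ρ r).measurableSet fun z hz => ?_
        simp only [(hFd z hz).deriv]
      have hlow := le_lintegral_annulus_norm_sq hk hρ0 hρ.2 hr
      rw [← hvol] at hlow
      have hup : volume ((fun w => 1 * w + (-(b * ρ ^ 2)) * conj w) '' (F '' A)) ≤
          volume (closedBall (0 : ℂ) (ρ⁻¹ + C * ρ ^ 2)) := by
        refine measure_mono ?_
        rintro _ ⟨_, ⟨z, hz, rfl⟩, rfl⟩
        exact mem_closedBall_zero_iff.2 (hρC z hz.1 hz.2)
      have hdet : |‖(1 : ℂ)‖ ^ 2 - ‖-(b * (ρ : ℂ) ^ 2)‖ ^ 2| = 1 - ‖b‖ ^ 2 * ρ ^ 4 := by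
        rw [norm_neg, norm_mul, norm_pow, Complex.norm_real, Real.norm_of_nonneg hρ0.le, norm_one,
          abs_of_nonneg]
        · ring
        · nlinarith
      rw [volume_image_smul_add_smul_conj, hdet, Complex.volume_closedBall] at hup
      have hfin := (mul_le_mul_right hlow
        (ENNReal.ofReal (1 - ‖b‖ ^ 2 * ρ ^ 4))).trans hup
      rw [← ENNReal.ofReal_mul (by linarith), ← ENNReal.ofReal_pow hρp,
        show (NNReal.pi : ENNReal) = ENNReal.ofReal Real.pi from ?_,
        ← ENNReal.ofReal_mul (by positivity), ENNReal.ofReal_le_ofReal_iff (by positivity)] at hfin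
      · have h2 : (1 - ‖b‖ ^ 2 * ρ ^ 4) *
            ((ρ ^ 2)⁻¹ - (r ^ 2)⁻¹ + ‖b‖ ^ 2 * (r ^ 2 - ρ ^ 2)) ≤ (ρ⁻¹ + C * ρ ^ 2) ^ 2 := by
          refine le_of_mul_le_mul_left ?_ Real.pi_pos
          linarith
        have h3 : (ρ⁻¹ + C * ρ ^ 2) ^ 2 = (ρ ^ 2)⁻¹ + 2 * C * ρ + C ^ 2 * ρ ^ 4 := by
          field_simp
          ring
        have h4 : ρ ^ 4 * (ρ ^ 2)⁻¹ = ρ ^ 2 := by field_simp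
        linear_combination h2 + h3 + ‖b‖ ^ 2 * h4
      · rw [← NNReal.coe_real_pi, ENNReal.ofReal_coe_nnreal]
    have hlim : Tendsto (fun ρ : ℝ =>
        -(r ^ 2)⁻¹ + ‖b‖ ^ 2 * (r ^ 2 - ρ ^ 2) - ‖b‖ ^ 2 * ρ ^ 2 -
          ‖b‖ ^ 2 * ρ ^ 4 * (-(r ^ 2)⁻¹ + ‖b‖ ^ 2 * (r ^ 2 - ρ ^ 2)) - 2 * C * ρ - C ^ 2 * ρ ^ 4)
        (𝓝[>] 0) (𝓝 (-(r ^ 2)⁻¹ + ‖b‖ ^ 2 * r ^ 2)) := by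
      refine Tendsto.mono_left (Continuous.tendsto' (by fun_prop) _ _ ?_) nhdsWithin_le_nhds
      ring
    linarith [le_of_tendsto hlim key]
  have hlim : Tendsto (fun r : ℝ => ‖b‖ ^ 2 * r ^ 2 * r ^ 2) (𝓝[<] 1) (𝓝 (‖b‖ ^ 2)) := by
    refine Tendsto.mono_left (Continuous.tendsto' (by fun_prop) _ _ ?_) nhdsWithin_le_nhds
    ring
  have hle : ‖b‖ ^ 2 ≤ 1 := by
    refine le_of_tendsto hlim ?_
    filter_upwards [Ioo_mem_nhdsLT (zero_lt_one' ℝ)] with r hr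
    have hr2 : 0 < r ^ 2 := pow_pos hr.1 2
    calc ‖b‖ ^ 2 * r ^ 2 * r ^ 2 ≤ (r ^ 2)⁻¹ * r ^ 2 := by gcongr; exact main r hr.1 hr.2
      _ = 1 := inv_mul_cancel₀ hr2.ne'
  nlinarith [norm_nonneg b]

end AreaTheorem

/-! ### Bieberbach's inequality and the Koebe one-quarter theorem -/

section Koebe

open Metric

theorem isSimplyConnected_ball {c : ℂ} {r : ℝ} (hr : 0 < r) : IsSimplyConnected (ball c r) := by
  have := (convex_ball c r).contractibleSpace (nonempty_ball.2 hr)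
  exact SimplyConnectedSpace.ofContractible _

/-- **Bieberbach's inequality** `|a₂| ≤ 2` for a normalized univalent function
`f z = z + a₂ z ^ 2 + ⋯` in the unit disk. -/
theorem norm_deriv_dslope_le_two {f : ℂ → ℂ} (hf : DifferentiableOn ℂ f (ball 0 1))
    (hi : InjOn f (ball 0 1)) (h0 : f 0 = 0) (h1 : deriv f 0 = 1) :
    ‖deriv (dslope f 0) 0‖ ≤ 2 := by
  have hn : ball (0 : ℂ) 1 ∈ 𝓝 0 := ball_mem_nhds 0 one_pos
  have hmem0 : (0 : ℂ) ∈ ball (0 : ℂ) 1 := mem_ball_self one_pos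
  set p := dslope f 0 with hp
  have hpd : DifferentiableOn ℂ p (ball 0 1) := (Complex.differentiableOn_dslope hn).2 hf
  have hfp : ∀ z, f z = z * p z := by
    intro z
    have := sub_smul_dslope f 0 z
    rw [h0] at this
    simpa using this.symm
  have hp0 : p 0 = 1 := by rw [hp, dslope_same, h1]
  have hpne : ∀ z ∈ ball (0 : ℂ) 1, p z ≠ 0 := by
    intro z hz e
    have : z = 0 := hi hz hmem0 (by rw [hfp z, e, h0, mul_zero])
    rw [this, hp0] at e
    exact one_ne_zero e
  obtain ⟨k, hkd, hksq⟩ := exists_differentiableOn_sq_eq isOpen_ball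
    (isSimplyConnected_ball one_pos) hpd hpne
  have hkne : ∀ z ∈ ball (0 : ℂ) 1, k z ≠ 0 := fun z hz e => hpne z hz (by
    rw [← hksq z hz, e]
    simp)
  have hk0 : k 0 ^ 2 = 1 := by rw [hksq 0 hmem0, hp0]
  -- The area theorem will be applied to the odd function m(z²) / z, a branch of 1 / √(f(z²)). Here
  -- m² p = 1 and m(0) = 1, so it is 1 / z + h with h'(0) = m'(0) = -a₂ / 2.
  set m : ℂ → ℂ := fun z => k 0 / k z with hm
  have hmd : DifferentiableOn ℂ m (ball 0 1) := (differentiableOn_const _).div hkd hkne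
  have hm0 : m 0 = 1 := div_self (hkne 0 hmem0)
  have hmp : ∀ z ∈ ball (0 : ℂ) 1, m z ^ 2 * p z = 1 := by
    intro z hz
    rw [← hksq z hz]
    simp only [m]
    rw [div_pow, hk0, one_div, inv_mul_cancel₀ (pow_ne_zero 2 (hkne z hz))]
  have hmder : 2 * deriv m 0 + deriv p 0 = 0 := by
    have hma := (hmd.differentiableAt hn).hasDerivAt
    have hpa := (hpd.differentiableAt hn).hasDerivAt
    have h2 := ((hma.pow 2).mul hpa).deriv
    have h3 : (m ^ 2 * p) =ᶠ[𝓝 0] fun _ => 1 := by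
      filter_upwards [hn] with z hz using hmp z hz
    rw [h3.deriv_eq, deriv_const] at h2
    simpa [hm0, hp0] using h2.symm
  have hsqm : ∀ z ∈ ball (0 : ℂ) 1, z ^ 2 ∈ ball (0 : ℂ) 1 := by
    intro z hz
    rw [mem_ball_zero_iff] at hz ⊢
    rw [norm_pow]
    exact pow_lt_one₀ (norm_nonneg z) hz two_ne_zero
  set q := dslope m 0 with hq
  have hqd : DifferentiableOn ℂ q (ball 0 1) := (Complex.differentiableOn_dslope hn).2 hmd
  have hmq : ∀ z, m z = 1 + z * q z := by
    intro z
    have := sub_smul_dslope m 0 z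
    rw [hm0, sub_zero, smul_eq_mul] at this
    rw [hq, this]
    ring
  set h : ℂ → ℂ := fun z => z * q (z ^ 2) with hh
  have hqc : DifferentiableOn ℂ (fun z => q (z ^ 2)) (ball 0 1) :=
    hqd.comp (differentiableOn_id.pow 2) hsqm
  have hhd : DifferentiableOn ℂ h (ball 0 1) := differentiableOn_id.mul hqc
  have hh' : deriv h 0 = deriv m 0 := by
    have h1 : HasDerivAt h _ 0 :=
      (hasDerivAt_id (0 : ℂ)).mul (hqc.differentiableAt hn).hasDerivAt
    rw [h1.deriv]
    simp [hq]
  have hF : ∀ z : ℂ, z ≠ 0 → z⁻¹ + h z = z⁻¹ * m (z ^ 2) := by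
    intro z hz
    rw [hmq]
    simp only [h]
    field_simp
  have hinj : InjOn (fun z => z⁻¹ + h z) (ball 0 1 \ {0}) := by
    rintro z ⟨hz, hz0⟩ w ⟨hw, hw0⟩ e
    have e' : z⁻¹ * m (z ^ 2) = w⁻¹ * m (w ^ 2) := by rw [← hF z hz0, ← hF w hw0]; exact e
    have hsq : ∀ x ∈ ball (0 : ℂ) 1, (x⁻¹ * m (x ^ 2)) ^ 2 = (f (x ^ 2))⁻¹ := by
      intro x hx
      rw [hfp, mul_inv, mul_pow, inv_pow, eq_inv_of_mul_eq_one_left (hmp _ (hsqm x hx))]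
    -- Squaring reduces to univalence of f; the sign left open by z² = w² is then fixed because
    -- m(z²) = m(w²).
    have hzw : z ^ 2 = w ^ 2 := by
      refine hi (hsqm z hz) (hsqm w hw) (inv_injective ?_)
      rw [← hsq z hz, ← hsq w hw, e']
    rw [hzw] at e'
    have hmne : m (w ^ 2) ≠ 0 := fun e0 => by simpa [e0] using hmp _ (hsqm w hw)
    exact inv_injective (mul_right_cancel₀ hmne e')
  have harea := norm_deriv_le_one_of_injOn_inv_add hhd hinj
  rw [hh'] at harea
  rw [eq_neg_of_add_eq_zero_right hmder, norm_neg, norm_mul, Complex.norm_two]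
  linarith

/-- The **Koebe one-quarter theorem** for normalized univalent functions. -/
theorem one_div_four_le_norm_of_notMem_image {f : ℂ → ℂ} (hf : DifferentiableOn ℂ f (ball 0 1))
    (hi : InjOn f (ball 0 1)) (h0 : f 0 = 0) (h1 : deriv f 0 = 1) {c : ℂ}
    (hc : c ∉ f '' ball 0 1) : 1 / 4 ≤ ‖c‖ := by
  have hn : ball (0 : ℂ) 1 ∈ 𝓝 0 := ball_mem_nhds 0 one_pos
  have hc0 : c ≠ 0 := by
    rintro rfl
    exact hc ⟨0, mem_ball_self one_pos, h0⟩
  have hcf : ∀ z ∈ ball (0 : ℂ) 1, c - f z ≠ 0 := fun z hz e => hc ⟨z, hz, (sub_eq_zero.1 e).symm⟩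
  -- The product f s = c f / (c - f) is again normalized and univalent, with second coefficient a₂ +
  -- 1 / c. Bieberbach's inequality for both functions gives |1 / c| ≤ 4.
  set s : ℂ → ℂ := fun z => c / (c - f z) with hs
  have hsd : DifferentiableOn ℂ s (ball 0 1) :=
    (differentiableOn_const c).div (hf.const_sub c) hcf
  have hfa : HasDerivAt f 1 0 := h1 ▸ (hf.differentiableAt hn).hasDerivAt
  have hs0 : s 0 = 1 := by simp only [s, h0, sub_zero, div_self hc0]
  have hsa : HasDerivAt s c⁻¹ 0 := by
    convert! (hasDerivAt_const (0 : ℂ) c).div (hfa.const_sub c)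
      (hcf 0 (mem_ball_self one_pos)) using 1
    rw [h0]
    field_simp
    ring
  set g : ℂ → ℂ := fun z => f z * s z with hg
  have hgd : DifferentiableOn ℂ g (ball 0 1) := hf.mul hsd
  have hg0 : g 0 = 0 := by simp only [g, h0, zero_mul]
  have hga : HasDerivAt g 1 0 := by
    have := hfa.mul hsa
    rw [h0, hs0, one_mul, zero_mul, add_zero] at this
    exact this
  have hgi : InjOn g (ball 0 1) := by
    intro z hz w hw e
    have e' : f z * (c / (c - f z)) = f w * (c / (c - f w)) := e
    rw [← mul_div_assoc, ← mul_div_assoc, div_eq_div_iff (hcf z hz) (hcf w hw)] at e'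
    refine hi hz hw (mul_left_cancel₀ (pow_ne_zero 2 hc0) ?_)
    linear_combination e'
  have hsl : dslope g 0 = fun z => dslope f 0 z * s z := by
    ext z
    rcases eq_or_ne z 0 with rfl | hz
    · rw [dslope_same, dslope_same, h1, hs0, hga.deriv, one_mul]
    · rw [dslope_of_ne _ hz, dslope_of_ne _ hz, slope_def_field, slope_def_field, h0, hg0, sub_zero,
        sub_zero, sub_zero, mul_div_right_comm]
  have hpa := ((Complex.differentiableOn_dslope hn).2 hf).differentiableAt hn
  have hder : deriv (dslope g 0) 0 = deriv (dslope f 0) 0 + c⁻¹ := by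
    have hprod : HasDerivAt (fun z => dslope f 0 z * s z) _ 0 := hpa.hasDerivAt.mul hsa
    rw [hsl, hprod.deriv, hs0, dslope_same, h1]
    ring
  have hb1 := norm_deriv_dslope_le_two hf hi h0 h1
  have hb2 := norm_deriv_dslope_le_two hgd hgi hg0 hga.deriv
  rw [hder] at hb2
  have hb3 : ‖c‖⁻¹ ≤ 4 := by
    rw [← norm_inv]
    have := norm_sub_le (deriv (dslope f 0) 0 + c⁻¹) (deriv (dslope f 0) 0)
    rw [add_sub_cancel_left] at this
    linarith
  have := (inv_le_comm₀ (norm_pos_iff.2 hc0) (by norm_num)).1 hb3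
  linarith

/-- The **Koebe one-quarter theorem**. -/
theorem norm_deriv_div_four_le_dist {f : ℂ → ℂ} (hf : DifferentiableOn ℂ f (ball 0 1))
    (hi : InjOn f (ball 0 1)) {c : ℂ} (hc : c ∉ f '' ball 0 1) :
    ‖deriv f 0‖ / 4 ≤ dist (f 0) c := by
  have hmem0 : (0 : ℂ) ∈ ball (0 : ℂ) 1 := mem_ball_self one_pos
  have hd := deriv_ne_zero_of_injOn isOpen_ball hf hi hmem0
  have ha := (((hf.differentiableAt (ball_mem_nhds 0 one_pos)).hasDerivAt.sub_const
    (f 0)).div_const (deriv f 0))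
  have key := one_div_four_le_norm_of_notMem_image
    (f := fun z => (f z - f 0) / deriv f 0) (c := (c - f 0) / deriv f 0)
    ((hf.sub_const _).div_const _)
    (fun z hz w hw e => hi hz hw (sub_left_injective ((div_left_inj' hd).1 e)))
    (by simp) (by rw [ha.deriv, div_self hd])
    (by
      rintro ⟨z, hz, e⟩
      exact hc ⟨z, hz, sub_left_injective ((div_left_inj' hd).1 e)⟩)
  rw [norm_div, le_div_iff₀ (norm_pos_iff.2 hd)] at key
  rw [dist_comm, dist_eq_norm]
  linarith

/-- Otherwise the inverse would be a bounded entire function, against Liouville. -/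
theorem image_ball_ne_univ {f : ℂ → ℂ} (hf : DifferentiableOn ℂ f (ball 0 1))
    (hi : InjOn f (ball 0 1)) : f '' ball 0 1 ≠ univ := by
  intro he
  have hl : LeftInvOn (Function.invFunOn f (ball 0 1)) f (ball 0 1) := hi.leftInvOn_invFunOn
  have hd := differentiableOn_leftInverse_of_injOn isOpen_ball hf hi hl
  rw [he, differentiableOn_univ] at hd
  have hb : Bornology.IsBounded (range (Function.invFunOn f (ball 0 1))) := by
    refine (isBounded_ball (x := (0 : ℂ)) (r := 1)).subset (range_subset_iff.2 fun w => ?_)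
    exact Function.invFunOn_mem (he.symm ▸ mem_univ w : w ∈ f '' ball 0 1)
  have hmem : (1 / 2 : ℂ) ∈ ball (0 : ℂ) 1 := by
    rw [mem_ball_zero_iff]
    norm_num
  have := hd.apply_eq_apply_of_bounded hb (f 0) (f (1 / 2))
  rw [hl (mem_ball_self one_pos), hl hmem] at this
  norm_num at this

theorem norm_deriv_div_four_le_boundaryDist {f : ℂ → ℂ} (hf : DifferentiableOn ℂ f (ball 0 1))
    (hi : InjOn f (ball 0 1)) : ‖deriv f 0‖ / 4 ≤ boundaryDist (f '' ball 0 1) (f 0) := by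
  have ho := isOpen_image_of_injOn isOpen_ball hf hi
  -- Essential, since `infDist` to the empty set is 0.
  have hne : (frontier (f '' ball 0 1)).Nonempty := by
    rw [nonempty_frontier_iff]
    exact ⟨⟨f 0, 0, mem_ball_self one_pos, rfl⟩, image_ball_ne_univ hf hi⟩
  refine (le_infDist hne).2 fun {c} hc => norm_deriv_div_four_le_dist hf hi fun hcm => ?_
  rw [ho.frontier_eq] at hc
  exact hc.2 hcm

/-- Koebe's theorem for the univalent function φ ∘ g. -/
theorem norm_deriv_mul_norm_deriv_le_boundaryDist {D : Set ℂ} (hD : IsOpen D) {φ : ℂ → ℂ}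
    (hφ : IsConformalMapping φ D) {g : ℂ → ℂ} (hg : IsConformalMapping g (ball 0 1))
    (him : g '' ball 0 1 = D) :
    ‖deriv φ (g 0)‖ * ‖deriv g 0‖ / 4 ≤ boundaryDist (φ '' D) (φ (g 0)) := by
  have hm : MapsTo g (ball 0 1) D := mapsTo_iff_image_subset.2 him.subset
  have hmem0 : (0 : ℂ) ∈ ball (0 : ℂ) 1 := mem_ball_self one_pos
  have := norm_deriv_div_four_le_boundaryDist (hφ.1.comp hg.1 hm) (hφ.2.comp hg.2 hm)
  rwa [deriv_comp 0 (hφ.1.differentiableAt (hD.mem_nhds (hm hmem0)))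
    (hg.1.differentiableAt (isOpen_ball.mem_nhds hmem0)), norm_mul, image_comp, him] at this

end Koebe

/-! ### The main theorem -/

theorem corollary2p3 (D : Set ℂ) (hDo : IsOpen D) (hDsc : IsSimplyConnected D)
    (hD : D ≠ Set.univ) (φ : ℂ → ℂ) (hφ : IsConformalMapping φ D) :
    ∃ f : ℂ → ℂ, IsLocallyUnivalentMeromorphic f D ∧
      (∀ z ∈ D, schwarzian f z = φ z) ∧
      ∀ z ∈ D, 0 < boundaryDist (schwarzian f '' D) (schwarzian f z) ∧
        ‖deriv (schwarzian f) z‖ / boundaryDist (schwarzian f '' D) (schwarzian f z)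
          ≤ 4 * hyperbolicDensity D z := by
  obtain ⟨f, hf, hS⟩ := exists_schwarzian_eq hDo hDsc hD hφ.1
  refine ⟨f, hf, hS, fun z hz => ?_⟩
  have hder : deriv (schwarzian f) z = deriv φ z := by
    refine Filter.EventuallyEq.deriv_eq ?_
    filter_upwards [hDo.mem_nhds hz] with w hw using hS w hw
  rw [image_congr hS, hS z hz, hder]
  have hle : ∀ g : ℂ → ℂ, IsConformalMapping g (Metric.ball 0 1) → g '' Metric.ball 0 1 = D →
      g 0 = z → 0 < ‖deriv g 0‖ ∧ ‖deriv φ z‖ * ‖deriv g 0‖ / 4 ≤ boundaryDist (φ '' D) (φ z) := by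
    rintro g hg him rfl
    exact ⟨norm_pos_iff.2 (deriv_ne_zero_of_injOn Metric.isOpen_ball hg.1 hg.2
      (Metric.mem_ball_self one_pos)), norm_deriv_mul_norm_deriv_le_boundaryDist hDo hφ hg him⟩
  obtain ⟨g₀, hd₀, hi₀, him₀, hz₀⟩ := exists_riemannMap_of_ball hDo hDsc hD hz
  have hφ' : 0 < ‖deriv φ z‖ := norm_pos_iff.2 (deriv_ne_zero_of_injOn hDo hφ.1 hφ.2 hz)
  have hpos : 0 < boundaryDist (φ '' D) (φ z) := by
    obtain ⟨hg₀, hle₀⟩ := hle g₀ ⟨hd₀, hi₀⟩ him₀ hz₀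
    exact lt_of_lt_of_le (by positivity) hle₀
  refine ⟨hpos, ?_⟩
  have hinf : ‖deriv φ z‖ / boundaryDist (φ '' D) (φ z) / 4 ≤ hyperbolicDensity D z := by
    -- The bound holds for every admissible g, so independence of g is not needed, only that some g
    -- exists.
    refine le_csInf ⟨_, g₀, ⟨hd₀, hi₀⟩, him₀, hz₀, rfl⟩ ?_
    rintro _ ⟨g, hg, him, hgz, rfl⟩
    obtain ⟨hg', hb⟩ := hle g hg him hgz
    rw [div_div, div_le_div_iff₀ (by positivity) hg']
    linarith
  linarith
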